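/- **Conventions.** Let $G$ be a finite abelian group of odd order with dual group $\widehat G$. A *Bohr set* $B$ in $G$ is given by a set $\Gamma\subset\widehat G$ and a real number $\rho\ge 0$, which are part of the data; its underlying set, also written $B$, is $\mathrm{Bohr}(\Gamma,\rho)=\{x\in G: |\gamma(x)-1|\le\rho \text{ for all }\gamma\in\Gamma\}$. Its rank is $|\Gamma|$ and its radius is $\rho$; we write $B_\tau=\mathrm{Bohr}(\Gamma,\tau\rho)$ and $2\cdot B=\mathrm{Bohr}(\Gamma^{1/2},\rho)$, where $\Gamma^{1/2}=\{\gamma\in\widehat G:\gamma^2\in\Gamma\}$ (its underlying set is $\{2x:x\in B\}$). We write $\mathrm{Bohr}(\Lambda,\delta)\le \mathrm{Bohr}(\Gamma,\rho)$ if $\Lambda\supset\Gamma$ and $\delta\le\rho$. A Bohr set $B$ of rank $d$ is *regular* if $1-12d|\tau|\le |B_{1+\tau}|/|B|\le 1+12d|\tau|$ whenever $12d|\tau|\le 1$. For $A\subset G$ let $T(A)$ be the number of triples $(x,y,z)\in A^3$ with $x+z=2y$ (trivial ones included), let $1_A$ be the indicator function of $A$ and $\mu_A=1_A/|A|$; further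 $f*g(x)=\sum_{y\in G} f(y)g(x-y)$ and $\|f\|_\infty=\max_{x\in G}|f(x)|$. **Proposition (Main iterator).** There are absolute constants $c,C>0$ such that the following holds. Let $G$ be a finite abelian group of odd order, let $B\subset G$ be a regular Bohr set of rank $d\ge 1$ and radius $\rho\le 2$, let $\alpha>0$, and let $A\subset B$ be a set of relative density $|A|/|B|\ge\alpha$. Then either 1. (many three-term progressions) $T(A)\ge \exp\left(-Cd\log(2d/\alpha)\right)|A|^2$, or 2. (density increment) there is a regular Bohr set $T$, contained in $B$ as a set and with $T\le B$ or $T\le 2\cdot B$, of rank at most $d+C\alpha^{-1}\log(2/\alpha)^4$ and radius at least $c\rho\,\alpha^{C\log(2/\alpha)}/d^5$, such that $\|1_A*\mu_T\|_\infty\ge\tfrac98\alpha$. -/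

import Mathlib

open Finset

noncomputable section

/-- The data of a Bohr set in a finite abelian group `G`: a set of characters and a radius.
The rank and the radius belong to the data; they cannot be read off from the underlying set. -/
structure BohrSet (G : Type*) [AddCommGroup G] where
  freq : Finset (AddChar G ℂ)
  radius : ℝ
  radius_nonneg : 0 ≤ radius

/-- The set `{x ∈ G : |γ(x) - 1| ≤ ρ for all γ ∈ Γ}`. -/
def bohr {G : Type*} [AddCommGroup G] [Fintype G]
    (Γ : Finset (AddChar G ℂ)) (ρ : ℝ) : Finset G :=
  open Classical in univ.filter fun x => ∀ γ ∈ Γ, ‖γ x - 1‖ ≤ ρ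

namespace BohrSet

variable {G : Type*} [AddCommGroup G]

/-- The rank: the number of characters. -/
def rank (B : BohrSet G) : ℕ := B.freq.card

/-- `B' ≤ B` (sub-Bohr set): more characters and a smaller radius. -/
instance : LE (BohrSet G) where
  le B' B := B.freq ⊆ B'.freq ∧ B'.radius ≤ B.radius

variable [Fintype G]

/-- The underlying set of a Bohr set. -/
def carrier (B : BohrSet G) : Finset G := bohr B.freq B.radius

/-- The underlying set of `B_τ`, the Bohr set with the same characters and radius `τ ρ`. -/
def narrow (B : BohrSet G) (τ : ℝ) : Finset G := bohr B.freq (τ * B.radius)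

/-- Regularity of a Bohr set of rank `d`: `1 - 12 d |τ| ≤ |B_{1+τ}| / |B| ≤ 1 + 12 d |τ|`
whenever `|τ| ≤ 1 / (12 d)`. -/
def IsRegular (B : BohrSet G) : Prop :=
  ∀ τ : ℝ, 12 * (B.rank : ℝ) * |τ| ≤ 1 →
    1 - 12 * (B.rank : ℝ) * |τ| ≤ ((B.narrow (1 + τ)).card : ℝ) / (B.carrier.card : ℝ) ∧
    ((B.narrow (1 + τ)).card : ℝ) / (B.carrier.card : ℝ) ≤ 1 + 12 * (B.rank : ℝ) * |τ|

/-- The dilate `2 · B`, with characters `Γ^{1/2} = {γ : γ² ∈ Γ}` and the same radius. When `G` has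
odd order, squaring is a bijection of the dual group, the rank of `2 · B` is that of `B`, and the
underlying set of `2 · B` is `{2x : x ∈ B}`. -/
def double (B : BohrSet G) : BohrSet G where
  freq := open Classical in univ.filter fun γ => γ ^ 2 ∈ B.freq
  radius := B.radius
  radius_nonneg := B.radius_nonneg

end BohrSet

/-- The indicator function `1_A`. -/
def ind {G : Type*} (A : Finset G) : G → ℝ := Set.indicator (A : Set G) 1

/-- The function `μ_A = 1_A / |A|`. -/
def unif {G : Type*} (A : Finset G) : G → ℝ := fun x => ind A x / (A.card : ℝ)

/-- Convolution `f * g (x) = ∑_y f(y) g(x - y)`. -/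
def conv {G : Type*} [AddCommGroup G] [Fintype G] (f g : G → ℝ) : G → ℝ :=
  fun x => ∑ y, f y * g (x - y)

/-- The supremum norm of a function on a finite group. -/
def supNorm {G : Type*} (f : G → ℝ) : ℝ := ⨆ x, |f x|

/-- `T(A)`: the number of three-term progressions `(x, y, z) ∈ A³` with `x + z = 2y`, the trivial
ones included. -/
def numAP {G : Type*} [AddCommGroup G] (A : Finset G) : ℕ :=
  open Classical in ((A ×ˢ A ×ˢ A).filter fun p : G × G × G => p.1 + p.2.2 = 2 • p.2.1).card

end

/-!
Regularity of the Bohr set `B` lets one pass to a translate of `A` which has density about `α` on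
two much smaller Bohr sets at once, `A₁ ⊆ B₁` and `A₂ ⊆ B₂` with `B₂` far narrower than `B₁`;
otherwise one of the two Bohr sets already carries a density increment. If the average of
`f = 1_{A₁} * μ_{A₁}` over `2 · A₂` is at least `α / 100`, then `A` has many progressions, because
Bohr sets of comparable radii have comparable sizes.

Suppose it is smaller. Random sampling in the manner of Croot and Sisask, with an error that is
relative to `α + f` rather than absolute, gives a large set `T` of almost periods of `f` inside a
dilated Bohr set `Bohr(Γ^{1/2}, σ)`. Convolving `f` repeatedly with the difference measure
`μ_T * μ_{-T}` therefore changes its average over `2 · A₂` little, and damps every character outside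
the large spectrum of `T` geometrically. By a version of Chang's theorem relative to a Bohr set, few
additional characters cut out a Bohr set `M` on which the large spectrum of `T` is almost trivial,
so that the smoothed function is uniformly close to a translation average of `f` over `M`. If
`1_{A₁} * μ_M` stayed below `9α / 8`, then these averages would be at least `α / 2` at every point,
which contradicts the smallness of `f` on average over `2 · A₂`.
-/

section BohrSets

variable {G : Type*} [AddCommGroup G]

theorem norm_addChar_add_sub_one_le [Finite G] (γ : AddChar G ℂ) (x y : G) :
    ‖γ (x + y) - 1‖ ≤ ‖γ x - 1‖ + ‖γ y - 1‖ := by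
  calc ‖γ (x + y) - 1‖ = ‖(γ x - 1) + γ x * (γ y - 1)‖ := by
        rw [AddChar.map_add_eq_mul]; ring_nf
    _ ≤ ‖γ x - 1‖ + ‖γ x * (γ y - 1)‖ := norm_add_le _ _
    _ = ‖γ x - 1‖ + ‖γ y - 1‖ := by rw [norm_mul, AddChar.norm_apply, one_mul]

theorem norm_addChar_sub_sub_one [Finite G] (γ : AddChar G ℂ) (x y : G) :
    ‖γ (x - y) - 1‖ = ‖γ x - γ y‖ := by
  have h : γ (x - y) - 1 = γ (-y) * (γ x - γ y) := by
    rw [mul_sub, ← AddChar.map_add_eq_mul, ← AddChar.map_add_eq_mul, neg_add_cancel,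
      AddChar.map_zero_eq_one, neg_add_eq_sub]
  rw [h, norm_mul, AddChar.norm_apply, one_mul]

theorem norm_addChar_neg_sub_one [Finite G] (γ : AddChar G ℂ) (x : G) :
    ‖γ (-x) - 1‖ = ‖γ x - 1‖ := by
  rw [← zero_sub, norm_addChar_sub_sub_one, AddChar.map_zero_eq_one, norm_sub_rev]

variable [Fintype G] {Γ Δ : Finset (AddChar G ℂ)} {ρ σ : ℝ} {x y : G}

theorem mem_bohr : x ∈ bohr Γ ρ ↔ ∀ γ ∈ Γ, ‖γ x - 1‖ ≤ ρ := by
  simp [bohr]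

theorem bohr_mono (h : ρ ≤ σ) : bohr Γ ρ ⊆ bohr Γ σ :=
  fun _ hx => mem_bohr.2 fun γ hγ => (mem_bohr.1 hx γ hγ).trans h

theorem bohr_anti (h : Γ ⊆ Δ) : bohr Δ ρ ⊆ bohr Γ ρ :=
  fun _ hx => mem_bohr.2 fun γ hγ => mem_bohr.1 hx γ (h hγ)

theorem zero_mem_bohr (h : 0 ≤ ρ) : (0 : G) ∈ bohr Γ ρ :=
  mem_bohr.2 fun γ _ => by simpa using h

theorem bohr_nonempty (h : 0 ≤ ρ) : (bohr Γ ρ).Nonempty := ⟨0, zero_mem_bohr h⟩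

theorem card_bohr_pos (h : 0 ≤ ρ) : (0 : ℝ) < #(bohr Γ ρ) :=
  Nat.cast_pos.2 (bohr_nonempty h).card_pos

theorem card_bohr_mono (h : ρ ≤ σ) : (#(bohr Γ ρ) : ℝ) ≤ #(bohr Γ σ) :=
  Nat.cast_le.2 (card_le_card (bohr_mono h))

theorem add_mem_bohr (hx : x ∈ bohr Γ ρ) (hy : y ∈ bohr Γ σ) : x + y ∈ bohr Γ (ρ + σ) :=
  mem_bohr.2 fun γ hγ => (norm_addChar_add_sub_one_le γ x y).trans
    (add_le_add (mem_bohr.1 hx γ hγ) (mem_bohr.1 hy γ hγ))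

theorem neg_mem_bohr (hx : x ∈ bohr Γ ρ) : -x ∈ bohr Γ ρ :=
  mem_bohr.2 fun γ hγ => (norm_addChar_neg_sub_one γ x).trans_le (mem_bohr.1 hx γ hγ)

theorem sub_mem_bohr (hx : x ∈ bohr Γ ρ) (hy : y ∈ bohr Γ σ) : x - y ∈ bohr Γ (ρ + σ) := by
  rw [sub_eq_add_neg]
  exact add_mem_bohr hx (neg_mem_bohr hy)

/-- The set `Γ^{1/2} = {γ : γ² ∈ Γ}` of square roots of the characters in `Γ`, which is the
frequency set of `2 · Bohr(Γ, ρ)`. -/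
noncomputable def sqrtFreq (Γ : Finset (AddChar G ℂ)) : Finset (AddChar G ℂ) :=
  open Classical in univ.filter fun γ => γ ^ 2 ∈ Γ

theorem mem_sqrtFreq {γ : AddChar G ℂ} : γ ∈ sqrtFreq Γ ↔ γ ^ 2 ∈ Γ := by
  simp [sqrtFreq]

theorem two_nsmul_bijective (hG : Odd (Fintype.card G)) :
    Function.Bijective fun x : G => 2 • x := by
  have hcop : (Nat.card G).Coprime 2 := by
    rwa [Nat.card_eq_fintype_card, Nat.coprime_two_right]
  exact (nsmulCoprime hcop).bijective

theorem sq_addChar_bijective (hG : Odd (Fintype.card G)) :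
    Function.Bijective fun γ : AddChar G ℂ => γ ^ 2 := by
  have hcop : (Nat.card (AddChar G ℂ)).Coprime 2 := by
    rwa [Nat.card_eq_fintype_card, AddChar.card_eq, Nat.coprime_two_right]
  exact (powCoprime hcop).bijective

theorem two_nsmul_mem_bohr_sqrtFreq (hG : Odd (Fintype.card G)) :
    2 • x ∈ bohr (sqrtFreq Γ) ρ ↔ x ∈ bohr Γ ρ := by
  simp only [mem_bohr, mem_sqrtFreq, AddChar.map_nsmul_eq_pow]
  exact ⟨fun h γ hγ => by
    obtain ⟨χ, rfl⟩ := (sq_addChar_bijective hG).2 γ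
    exact h χ hγ, fun h χ hχ => h _ hχ⟩

theorem card_sqrtFreq (hG : Odd (Fintype.card G)) (Γ : Finset (AddChar G ℂ)) :
    #(sqrtFreq Γ) = #Γ := by
  refine card_bij (fun γ _ => γ ^ 2) (fun γ hγ => mem_sqrtFreq.1 hγ)
    (fun γ _ χ _ h => (sq_addChar_bijective hG).1 h) fun γ hγ => ?_
  obtain ⟨χ, rfl⟩ := (sq_addChar_bijective hG).2 γ
  exact ⟨χ, mem_sqrtFreq.2 hγ, rfl⟩

theorem card_bohr_sqrtFreq (hG : Odd (Fintype.card G)) (Γ : Finset (AddChar G ℂ)) (ρ : ℝ) :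
    #(bohr (sqrtFreq Γ) ρ) = #(bohr Γ ρ) := by
  symm
  refine card_bij (fun x _ => 2 • x) (fun x hx => (two_nsmul_mem_bohr_sqrtFreq hG).2 hx)
    (fun x _ y _ h => (two_nsmul_bijective hG).1 h) fun y hy => ?_
  obtain ⟨x, rfl⟩ := (two_nsmul_bijective hG).2 y
  exact ⟨x, (two_nsmul_mem_bohr_sqrtFreq hG).1 hy, rfl⟩

theorem bohr_sqrtFreq_subset (hG : Odd (Fintype.card G)) (Γ : Finset (AddChar G ℂ)) (ρ : ℝ) :
    bohr (sqrtFreq Γ) ρ ⊆ bohr Γ (2 * ρ) := by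
  intro y hy
  obtain ⟨x, rfl⟩ := (two_nsmul_bijective hG).2 y
  have hx : x ∈ bohr Γ ρ := (two_nsmul_mem_bohr_sqrtFreq hG).1 hy
  simpa only [two_nsmul, two_mul] using add_mem_bohr hx hx

end BohrSets

section BohrSize

theorem norm_sub_le_abs_arg_sub {z w : ℂ} (hz : ‖z‖ = 1) (hw : ‖w‖ = 1) :
    ‖z - w‖ ≤ |z.arg - w.arg| := by
  have exp_arg {v : ℂ} (hv : ‖v‖ = 1) : Complex.exp (v.arg * Complex.I) = v := by
    simpa [hv] using Complex.norm_mul_exp_arg_mul_I v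
  have h : z - w = Complex.exp (w.arg * Complex.I) *
      (Complex.exp (Complex.I * ((z.arg - w.arg : ℝ) : ℂ)) - 1) := by
    rw [mul_sub, ← Complex.exp_add, mul_one, exp_arg hw]
    conv_lhs => rw [← exp_arg hz]
    congr 2
    push_cast
    ring
  rw [h, norm_mul, Complex.norm_exp_ofReal_mul_I, one_mul]
  exact Real.norm_exp_I_mul_ofReal_sub_one_le

theorem abs_arg_le_of_norm_eq_one {z : ℂ} (hz : ‖z‖ = 1) :
    |z.arg| ≤ Real.pi / 2 * ‖z - 1‖ := by
  rw [← Complex.angle_one_right (norm_ne_zero_iff.1 (hz ▸ one_ne_zero))]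
  exact Complex.angle_le_mul_norm_sub hz norm_one

theorem card_le_card_mul_card_of_sub_mem {G ι : Type*} [AddGroup G]
    {A D : Finset G} {t : Finset ι} (F : G → ι) (hF : ∀ x ∈ A, F x ∈ t)
    (hD : ∀ x ∈ A, ∀ y ∈ A, F x = F y → x - y ∈ D) : #A ≤ #D * #t := by
  classical
  refine card_le_mul_card_image_of_maps_to hF _ fun b _ => ?_
  rcases (A.filter fun x => F x = b).eq_empty_or_nonempty with h | ⟨y, hy⟩
  · simp [h]
  · rw [mem_filter] at hy
    refine card_le_card_of_injOn (· - y) (fun x hx => ?_) fun _ _ _ _ h => sub_left_injective h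
    obtain ⟨hxA, hxb⟩ := mem_filter.1 (mem_coe.1 hx)
    exact hD x hxA y hy.1 (hxb.trans hy.2.symm)

variable {G : Type*} [AddCommGroup G]

theorem norm_addChar_sub_sub_one_le_of_floor_eq [Finite G] {γ : AddChar G ℂ} {σ c : ℝ} (hσ : 0 < σ)
    {x y : G} (h : ⌊(γ x).arg / σ + c⌋ = ⌊(γ y).arg / σ + c⌋) : ‖γ (x - y) - 1‖ ≤ σ := by
  have hlt := Int.abs_sub_lt_one_of_floor_eq_floor h
  rw [add_sub_add_right_eq_sub, ← sub_div, abs_div, abs_of_pos hσ, div_lt_one hσ] at hlt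
  rw [norm_addChar_sub_sub_one]
  exact (norm_sub_le_abs_arg_sub (AddChar.norm_apply γ x) (AddChar.norm_apply γ y)).trans hlt.le

variable [Fintype G]

/- Each argument of a point of `Bohr(Γ, ρ)` lies in an interval of length `πρ`; cutting these
intervals into at most `5/τ` pieces of length `τρ` puts points of the same cell at a difference in
`Bohr(Γ, τρ)`. -/
theorem card_bohr_le_mul_card_bohr (Γ : Finset (AddChar G ℂ)) {ρ τ : ℝ} (hρ : 0 ≤ ρ) (hτ : 0 < τ)
    (hτ1 : τ ≤ 1) : (#(bohr Γ ρ) : ℝ) ≤ (5 / τ) ^ #Γ * #(bohr Γ (τ * ρ)) := by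
  classical
  have h5 : 1 ≤ 5 / τ := by rw [le_div_iff₀ hτ]; linarith
  rcases hρ.eq_or_lt with rfl | hρ
  · rw [mul_zero]
    exact le_mul_of_one_le_left (Nat.cast_nonneg _) (one_le_pow₀ h5)
  have hσ : 0 < τ * ρ := mul_pos hτ hρ
  set a : ℝ := Real.pi / (2 * τ) with ha
  have ha2 : a + a = Real.pi / τ := by rw [ha]; field_simp; norm_num
  have ha0 : 0 < a := by positivity
  let cell (x : G) (γ : Γ) : ℤ := ⌊((γ : AddChar G ℂ) x).arg / (τ * ρ) + a⌋
  have harg : ∀ x ∈ bohr Γ ρ, ∀ γ ∈ Γ, |(γ x).arg / (τ * ρ)| ≤ a := by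
    intro x hx γ hγ
    rw [abs_div, abs_of_pos hσ, div_le_iff₀ hσ]
    calc |(γ x).arg| ≤ Real.pi / 2 * ‖γ x - 1‖ := abs_arg_le_of_norm_eq_one (AddChar.norm_apply γ x)
      _ ≤ Real.pi / 2 * ρ := by gcongr; exact mem_bohr.1 hx γ hγ
      _ = a * (τ * ρ) := by rw [ha]; field_simp
  have hcell : ∀ x ∈ bohr Γ ρ, cell x ∈ Fintype.piFinset fun _ : Γ => Icc 0 ⌊a + a⌋ := by
    intro x hx
    refine Fintype.mem_piFinset.2 fun γ => ?_
    obtain ⟨hl, hu⟩ := abs_le.1 (harg x hx γ γ.2)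
    exact mem_Icc.2 ⟨Int.floor_nonneg.2 (by linarith), Int.floor_mono (by linarith)⟩
  have hcount := card_le_card_mul_card_of_sub_mem (D := bohr Γ (τ * ρ)) cell hcell
    fun x _ y _ hxy => mem_bohr.2 fun γ hγ =>
      norm_addChar_sub_sub_one_le_of_floor_eq hσ (congrFun hxy ⟨γ, hγ⟩)
  have hIcc : (#(Icc 0 ⌊a + a⌋) : ℝ) ≤ 5 / τ := by
    have : 0 ≤ ⌊a + a⌋ := Int.floor_nonneg.2 (by positivity)
    calc (#(Icc 0 ⌊a + a⌋) : ℝ) = ⌊a + a⌋ + 1 := by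
          rw [Int.card_Icc, sub_zero, ← Int.cast_natCast, Int.toNat_of_nonneg (by positivity)]
          push_cast; rfl
      _ ≤ a + a + 1 := by gcongr; exact Int.floor_le _
      _ ≤ 5 / τ := by
          rw [ha2, le_div_iff₀ hτ, add_mul, div_mul_cancel₀ _ hτ.ne']
          linarith [Real.pi_le_four]
  calc (#(bohr Γ ρ) : ℝ) ≤ #(bohr Γ (τ * ρ)) * (#(Icc 0 ⌊a + a⌋) : ℝ) ^ #Γ := by
        simp only [Fintype.card_piFinset, prod_const, card_univ, Fintype.card_coe] at hcount
        exact_mod_cast hcount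
    _ ≤ (5 / τ) ^ #Γ * #(bohr Γ (τ * ρ)) := by
        rw [mul_comm]
        gcongr

end BohrSize

section MonotoneSlope

open MeasureTheory

theorem exists_disjoint_uIcc_cover {p q R : ℝ} {s : ℝ → ℝ} (hne : ∀ t ∈ Set.Icc p q, s t ≠ t)
    (hR : ∀ t ∈ Set.Icc p q, |s t - t| ≤ R) :
    ∃ u ⊆ Set.Icc p q, u.Countable ∧ u.PairwiseDisjoint (fun t => Set.uIcc t (s t)) ∧
      ENNReal.ofReal (q - p) ≤ 4 * ∑' t : u, ENNReal.ofReal |s t - t| := by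
  obtain ⟨u, hu, hdisj, hcov⟩ := Vitali.exists_disjoint_subfamily_covering_enlargement
    (fun t => Set.uIcc t (s t)) (Set.Icc p q) (fun t => |s t - t|) (3 / 2) (by norm_num)
    (fun t _ => abs_nonneg _) R hR fun t _ => Set.nonempty_uIcc
  have hcount : u.Countable := hdisj.countable_of_nonempty_interior fun t ht => by
    rw [Set.uIcc, interior_Icc, Set.nonempty_Ioo, inf_lt_sup]
    exact (hne t (hu ht)).symm
  have hsub : Set.Icc p q ⊆ ⋃ b ∈ u, Metric.closedBall ((b + s b) / 2) (2 * |s b - b|) := by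
    intro t ht
    obtain ⟨b, hb, ⟨x, hxt, hxb⟩, hle⟩ := hcov t ht
    refine Set.mem_biUnion hb ?_
    have hxt' : |x - t| ≤ |s t - t| := Set.abs_sub_left_of_mem_uIcc hxt
    have hxb' : |x - (b + s b) / 2| ≤ |s b - b| / 2 := by
      rcases Set.mem_uIcc.1 hxb with h | h
      · rw [abs_of_nonneg (by linarith : 0 ≤ s b - b), abs_le]
        constructor <;> linarith
      · rw [abs_of_nonpos (by linarith : s b - b ≤ 0), abs_le]
        constructor <;> linarith
    calc |t - (b + s b) / 2| ≤ |t - x| + |x - (b + s b) / 2| := abs_sub_le _ _ _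
      _ ≤ 2 * |s b - b| := by rw [abs_sub_comm t x]; linarith
  refine ⟨u, hu, hcount, hdisj, ?_⟩
  calc ENNReal.ofReal (q - p) = volume (Set.Icc p q) := Real.volume_Icc.symm
    _ ≤ ∑' b : u, volume (Metric.closedBall (((b : ℝ) + s b) / 2) (2 * |s b - b|)) :=
        (measure_mono hsub).trans (measure_biUnion_le volume hcount _)
    _ = ∑' b : u, 4 * ENNReal.ofReal |s b - b| := by
        congr with b
        rw [Real.volume_closedBall, ← mul_assoc, ENNReal.ofReal_mul (by norm_num)]
        norm_num
    _ = 4 * ∑' b : u, ENNReal.ofReal |s b - b| := ENNReal.tsum_mul_left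

theorem disjoint_uIoo_of_disjoint_uIcc {g : ℝ → ℝ} (hg : Monotone g) {a b c d : ℝ}
    (h : Disjoint (Set.uIcc a b) (Set.uIcc c d)) :
    Disjoint (Set.uIoo (g a) (g b)) (Set.uIoo (g c) (g d)) := by
  simp only [Set.uIoo, ← hg.map_min, ← hg.map_max, Set.uIcc, Set.disjoint_left, Set.mem_Icc,
    Set.mem_Ioo] at h ⊢
  intro x hx hx'
  have h₁ : a ⊔ b < c ⊓ d ∨ c ⊔ d < a ⊓ b := by
    by_contra! hcon
    refine h (a := (a ⊓ b) ⊔ (c ⊓ d)) ⟨le_sup_left, sup_le inf_le_sup hcon.1⟩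
      ⟨le_sup_right, sup_le hcon.2 inf_le_sup⟩
  rcases h₁ with h₁ | h₁
  · exact (hx.2.trans_le (hg h₁.le)).asymm hx'.1
  · exact (hx'.2.trans_le (hg h₁.le)).asymm hx.1

theorem tsum_abs_sub_le_of_monotone {g s : ℝ → ℝ} (hg : Monotone g) {m M : ℝ} {u : Set ℝ}
    (hm : ∀ t, m ≤ g t) (hM : ∀ t, g t ≤ M) (hu : u.Countable)
    (hdisj : u.PairwiseDisjoint fun t => Set.uIcc t (s t)) :
    ∑' t : u, ENNReal.ofReal |g (s t) - g t| ≤ ENNReal.ofReal (M - m) := by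
  calc ∑' t : u, ENNReal.ofReal |g (s t) - g t|
      = ∑' t : u, volume (Set.uIoo (g t) (g (s t))) := by simp only [Real.volume_uIoo]
    _ = volume (⋃ t ∈ u, Set.uIoo (g t) (g (s t))) := by
        symm
        refine measure_biUnion hu (fun a ha b hb hab => ?_) fun _ _ => by
          simpa only [Set.uIoo] using measurableSet_Ioo
        exact disjoint_uIoo_of_disjoint_uIcc hg (hdisj ha hb hab)
    _ ≤ volume (Set.Icc m M) := by
        refine measure_mono (Set.iUnion₂_subset fun t _ x hx => ?_)
        rw [Set.uIoo, Set.mem_Ioo] at hx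
        exact ⟨(le_inf (hm _) (hm _)).trans hx.1.le, hx.2.le.trans (sup_le (hM _) (hM _))⟩
    _ = ENNReal.ofReal (M - m) := Real.volume_Icc

theorem exists_forall_abs_sub_le_of_monotone {g : ℝ → ℝ} (hg : Monotone g) {m M c p q : ℝ}
    (hm : ∀ t, m ≤ g t) (hM : ∀ t, g t ≤ M) (hc : 0 < c) (h : 4 * (M - m) < c * (q - p)) :
    ∃ t ∈ Set.Icc p q, ∀ s, |g s - g t| ≤ c * |s - t| := by
  by_contra! hbad
  choose! s hs using hbad
  have hdiff (a b : ℝ) : |g a - g b| ≤ M - m := abs_le.2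
    ⟨by linarith [hM b, hm a], by linarith [hM a, hm b]⟩
  have hMm : 0 ≤ M - m := (abs_nonneg _).trans (hdiff 0 0)
  obtain ⟨u, hu, hcount, hdisj, hcov⟩ := exists_disjoint_uIcc_cover (p := p) (q := q) (s := s)
    (R := (M - m) / c) (fun t ht heq => by simpa [heq] using hs t ht)
    fun t ht => by
      rw [le_div_iff₀' hc]
      exact (hs t ht).le.trans (hdiff _ _)
  refine h.not_ge ((ENNReal.ofReal_le_ofReal_iff (by linarith)).1 ?_)
  calc ENNReal.ofReal (c * (q - p)) = ENNReal.ofReal c * ENNReal.ofReal (q - p) :=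
        ENNReal.ofReal_mul hc.le
    _ ≤ ENNReal.ofReal c * (4 * ∑' t : u, ENNReal.ofReal |s t - t|) := by gcongr
    _ = 4 * ∑' t : u, ENNReal.ofReal (c * |s t - t|) := by
        simp only [ENNReal.ofReal_mul hc.le, ENNReal.tsum_mul_left]
        ring
    _ ≤ 4 * ∑' t : u, ENNReal.ofReal |g (s t) - g t| := by
        gcongr with t
        exact (hs t (hu t.2)).le
    _ ≤ 4 * ENNReal.ofReal (M - m) := by
        gcongr
        exact tsum_abs_sub_le_of_monotone hg hm hM hcount hdisj
    _ = ENNReal.ofReal (4 * (M - m)) := by rw [ENNReal.ofReal_mul (by norm_num)]; norm_num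

end MonotoneSlope

section Regularity

theorem exp_two_thirds_mul_le {x : ℝ} (h0 : 0 ≤ x) (h1 : x ≤ 1) :
    Real.exp (2 / 3 * x) ≤ 1 + x := by
  have hconv := convexOn_exp.2 (Set.mem_univ 0) (Set.mem_univ (2 / 3)) (sub_nonneg.2 h1) h0
    (sub_add_cancel 1 x)
  simp only [smul_eq_mul, mul_zero, zero_add, Real.exp_zero, mul_one] at hconv
  have h2 : Real.exp (2 / 3) ≤ 2 := by
    rw [← Real.le_log_iff_exp_le two_pos]
    linarith [Real.log_two_gt_d9]
  rw [mul_comm]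
  nlinarith

theorem le_one_add_mul_of_log_sub_log_le {M N τ : ℝ} {n : ℕ} (hM : 0 < M) (hN : 0 < N)
    (h0 : 0 ≤ τ) (h1 : 12 * (n : ℝ) * τ ≤ 1)
    (h : Real.log N - Real.log M ≤ 8 * n * Real.log (1 + τ)) : N ≤ (1 + 12 * n * τ) * M := by
  have hle : Real.log N ≤ 2 / 3 * (12 * n * τ) + Real.log M := by
    calc Real.log N ≤ 8 * n * Real.log (1 + τ) + Real.log M := sub_le_iff_le_add.1 h
      _ ≤ 8 * n * τ + Real.log M := by
          gcongr
          linarith [Real.log_le_sub_one_of_pos (by linarith : 0 < 1 + τ)]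
      _ = 2 / 3 * (12 * n * τ) + Real.log M := by ring
  rw [Real.log_le_iff_le_exp hN, Real.exp_add, Real.exp_log hM] at hle
  exact hle.trans (by gcongr; exact exp_two_thirds_mul_le (by positivity) h1)

theorem one_add_mul_le_of_le_log_sub_log {M N τ : ℝ} {n : ℕ} (hM : 0 < M) (hN : 0 < N)
    (h0 : τ ≤ 0) (h1 : -1 < τ) (h : 8 * n * Real.log (1 + τ) ≤ Real.log N - Real.log M) :
    (1 + 12 * n * τ) * M ≤ N := by
  have hpos : 0 < 1 + τ := by linarith
  have hle : (8 * n : ℕ) * Real.log (1 + τ) + Real.log M ≤ Real.log N := by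
    push_cast
    linarith
  rw [Real.le_log_iff_exp_le hN, Real.exp_add, ← Real.log_pow, Real.exp_log (by positivity),
    Real.exp_log hM] at hle
  have hbern := one_add_mul_le_pow (by linarith : -2 ≤ τ) (8 * n)
  push_cast at hbern
  have hnτ : (n : ℝ) * τ ≤ 0 := mul_nonpos_of_nonneg_of_nonpos n.cast_nonneg h0
  exact hle.trans' (by gcongr; linarith)

variable {G : Type*} [AddCommGroup G] [Fintype G] {Γ : Finset (AddChar G ℂ)} {ρ σ κ : ℝ}

/-- Regularity of the Bohr set with frequency set `Γ` and radius `ρ`, stated without division. -/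
def IsRegularRadius (Γ : Finset (AddChar G ℂ)) (ρ : ℝ) : Prop :=
  ∀ τ : ℝ, 12 * (#Γ : ℝ) * |τ| ≤ 1 →
    (1 - 12 * (#Γ : ℝ) * |τ|) * #(bohr Γ ρ) ≤ #(bohr Γ ((1 + τ) * ρ)) ∧
    (#(bohr Γ ((1 + τ) * ρ)) : ℝ) ≤ (1 + 12 * (#Γ : ℝ) * |τ|) * #(bohr Γ ρ)

theorem BohrSet.isRegular_iff (B : BohrSet G) :
    B.IsRegular ↔ IsRegularRadius B.freq B.radius := by
  have h := card_bohr_pos (Γ := B.freq) B.radius_nonneg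
  simp only [BohrSet.IsRegular, IsRegularRadius, BohrSet.rank, BohrSet.narrow, BohrSet.carrier,
    le_div_iff₀ h, div_le_iff₀ h]

theorem IsRegularRadius.sqrtFreq (h : IsRegularRadius Γ ρ) (hG : Odd (Fintype.card G)) :
    IsRegularRadius (sqrtFreq Γ) ρ := by
  simpa only [IsRegularRadius, card_bohr_sqrtFreq hG, card_sqrtFreq hG] using h

theorem IsRegularRadius.card_le (h : IsRegularRadius Γ ρ) (hκ : 0 ≤ κ)
    (hκ1 : 12 * (#Γ : ℝ) * κ ≤ 1) (hσ : σ ≤ (1 + κ) * ρ) :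
    (#(bohr Γ σ) : ℝ) ≤ (1 + 12 * (#Γ : ℝ) * κ) * #(bohr Γ ρ) := by
  rw [← abs_of_nonneg hκ] at hκ1
  have := (h κ hκ1).2
  rw [abs_of_nonneg hκ] at this
  exact (card_bohr_mono hσ).trans this

theorem IsRegularRadius.le_card (h : IsRegularRadius Γ ρ) (hκ : 0 ≤ κ)
    (hκ1 : 12 * (#Γ : ℝ) * κ ≤ 1) (hσ : (1 - κ) * ρ ≤ σ) :
    (1 - 12 * (#Γ : ℝ) * κ) * #(bohr Γ ρ) ≤ #(bohr Γ σ) := by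
  rw [← abs_of_nonneg hκ, ← abs_neg] at hκ1
  have := (h (-κ) hκ1).1
  rw [abs_neg, abs_of_nonneg hκ, ← sub_eq_add_neg] at this
  exact this.trans (card_bohr_mono hσ)

theorem isRegularRadius_zero (Γ : Finset (AddChar G ℂ)) : IsRegularRadius Γ 0 := by
  intro τ _
  have h : 0 ≤ 12 * (#Γ : ℝ) * |τ| := by positivity
  rw [mul_zero]
  constructor
  · exact mul_le_of_le_one_left (Nat.cast_nonneg _) (by linarith)
  · exact le_mul_of_one_le_left (Nat.cast_nonneg _) (by linarith)

theorem isRegularRadius_of_abs_log_sub_le (hΓ : 1 ≤ #Γ) (hσ : 0 ≤ σ)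
    (h : ∀ τ : ℝ, |τ| ≤ 1 / 12 →
      |Real.log #(bohr Γ ((1 + τ) * σ)) - Real.log #(bohr Γ σ)| ≤ 8 * #Γ * |Real.log (1 + τ)|) :
    IsRegularRadius Γ σ := by
  intro τ hτ
  have hd : (1 : ℝ) ≤ #Γ := Nat.one_le_cast.2 hΓ
  have hτ12 : |τ| ≤ 1 / 12 := by nlinarith [abs_nonneg τ]
  have hpos : 0 < 1 + τ := by linarith [neg_abs_le τ]
  have hlog := h τ hτ12
  have hN := card_bohr_pos (Γ := Γ) hσ
  have hNτ := card_bohr_pos (Γ := Γ) (mul_nonneg hpos.le hσ)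
  rcases le_total 0 τ with h0 | h0
  · rw [abs_of_nonneg (Real.log_nonneg (by linarith))] at hlog
    rw [abs_of_nonneg h0] at hτ ⊢
    have hmono : (#(bohr Γ σ) : ℝ) ≤ #(bohr Γ ((1 + τ) * σ)) := card_bohr_mono (by nlinarith)
    exact ⟨(mul_le_of_le_one_left hN.le (sub_le_self 1 (by positivity))).trans hmono,
      le_one_add_mul_of_log_sub_log_le hN hNτ h0 hτ (abs_le.1 hlog).2⟩
  · rw [abs_of_nonpos (Real.log_nonpos hpos.le (by linarith)), mul_neg] at hlog
    rw [abs_of_nonpos h0, mul_neg, sub_neg_eq_add]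
    have hmono : (#(bohr Γ ((1 + τ) * σ)) : ℝ) ≤ #(bohr Γ σ) := card_bohr_mono (by nlinarith)
    refine ⟨one_add_mul_le_of_le_log_sub_log hN hNτ h0 (by linarith)
      (by linarith [(abs_le.1 hlog).1]), hmono.trans (le_mul_of_one_le_left hN.le ?_)⟩
    rw [le_add_iff_nonneg_right, neg_nonneg]
    exact mul_nonpos_of_nonneg_of_nonpos (by positivity) h0

theorem abs_log_one_add_le {τ : ℝ} (h : |τ| ≤ 1 / 12) : |Real.log (1 + τ)| ≤ 1 / 11 := by
  have hτ := abs_le.1 h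
  have hpos : 0 < 1 + τ := by linarith
  refine abs_le.2 ⟨?_, by linarith [Real.log_le_sub_one_of_pos hpos]⟩
  have : (1 + τ)⁻¹ ≤ 12 / 11 := by
    rw [inv_le_comm₀ hpos (by norm_num)]
    linarith
  linarith [Real.one_sub_inv_le_log_of_pos hpos]

theorem log_card_bohr_le (hρ : 0 ≤ ρ) : Real.log #(bohr Γ ρ) - Real.log #(bohr Γ (1 / 8 * ρ)) ≤
    #Γ * (16 / 3 * Real.log 2) := by
  have hpos := card_bohr_pos (Γ := Γ) (mul_nonneg (by norm_num : (0 : ℝ) ≤ 1 / 8) hρ)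
  have hle := Real.log_le_log (card_bohr_pos hρ)
    (card_bohr_le_mul_card_bohr Γ hρ (τ := 1 / 8) (by norm_num) (by norm_num))
  rw [Real.log_mul (by positivity) hpos.ne', Real.log_pow] at hle
  have h40 : 3 * Real.log (5 / (1 / 8)) ≤ 16 * Real.log 2 := by
    have := Real.log_le_log (by norm_num) (by norm_num : ((5 / (1 / 8)) ^ 3 : ℝ) ≤ 2 ^ 16)
    rw [Real.log_pow, Real.log_pow] at this
    exact_mod_cast this
  have : (#Γ : ℝ) * Real.log (5 / (1 / 8)) ≤ #Γ * (16 / 3 * Real.log 2) := by gcongr; linarith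
  linarith

theorem exists_isRegularRadius (hΓ : 1 ≤ #Γ) (hρ : 0 ≤ ρ) :
    ∃ σ, ρ / 8 ≤ σ ∧ σ ≤ ρ ∧ IsRegularRadius Γ σ := by
  rcases hρ.eq_or_lt with rfl | hρ
  · exact ⟨0, by simp, le_rfl, isRegularRadius_zero Γ⟩
  have hd : (1 : ℝ) ≤ #Γ := Nat.one_le_cast.2 hΓ
  have h8 : Real.log 8 = 3 * Real.log 2 := by
    rw [(by norm_num : (8 : ℝ) = 2 ^ 3), Real.log_pow]; norm_num
  have hl := Real.log_two_gt_d9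
  let N (s : ℝ) : ℝ := Real.log #(bohr Γ (Real.exp s * ρ))
  let clamp (s : ℝ) : ℝ := max (-Real.log 8) (min 0 s)
  have hN : Monotone N := fun s t hst =>
    Real.log_le_log (card_bohr_pos (by positivity)) (card_bohr_mono (by gcongr))
  have clamp_eq {s : ℝ} (h₁ : -Real.log 8 ≤ s) (h₂ : s ≤ 0) : clamp s = s := by
    simp only [clamp, min_eq_right h₂, max_eq_right h₁]
  have hgrowth : N 0 - N (-Real.log 8) ≤ #Γ * (16 / 3 * Real.log 2) := by
    simpa [N, Real.exp_neg, Real.exp_log] using log_card_bohr_le (Γ := Γ) hρ.le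
  obtain ⟨t, ⟨hpt, htq⟩, ht⟩ := exists_forall_abs_sub_le_of_monotone (g := N ∘ clamp)
    (m := N (-Real.log 8)) (M := N 0) (c := 8 * #Γ) (p := -Real.log 8 + 1 / 11) (q := -(1 / 11))
    (hN.comp fun s t hst => max_le_max le_rfl (min_le_min le_rfl hst))
    (fun _ => hN (le_max_left _ _)) (fun _ => hN (max_le (by linarith) (min_le_left _ _)))
    (by positivity) (by nlinarith)
  refine ⟨Real.exp t * ρ, ?_, ?_, isRegularRadius_of_abs_log_sub_le hΓ (by positivity) ?_⟩
  · have : 1 / 8 ≤ Real.exp t := by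
      rw [← Real.log_le_iff_le_exp (by norm_num), one_div, Real.log_inv]
      linarith
    linarith [mul_le_mul_of_nonneg_right this hρ.le]
  · exact mul_le_of_le_one_left hρ.le (Real.exp_le_one_iff.2 (by linarith))
  · intro τ hτ
    have hpos : 0 < 1 + τ := by linarith [(abs_le.1 hτ).1]
    have hlog := abs_le.1 (abs_log_one_add_le hτ)
    have hdiff := ht (t + Real.log (1 + τ))
    simp only [Function.comp_apply, clamp_eq (by linarith : -Real.log 8 ≤ t) (by linarith),
      clamp_eq (by linarith : -Real.log 8 ≤ t + Real.log (1 + τ)) (by linarith)] at hdiff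
    simpa only [N, add_sub_cancel_left, Real.exp_add, Real.exp_log hpos,
      mul_comm (Real.exp t) (1 + τ), mul_assoc (1 + τ)] using hdiff

end Regularity

section Convolution

variable {G : Type*} {A : Finset G} {x : G}

theorem ind_of_mem (h : x ∈ A) : ind A x = 1 := by
  simp [ind, h]

theorem ind_of_notMem (h : x ∉ A) : ind A x = 0 := by
  simp [ind, h]

theorem ind_nonneg (A : Finset G) (x : G) : 0 ≤ ind A x :=
  Set.indicator_nonneg (fun _ _ => zero_le_one) x

theorem ind_le_one (A : Finset G) (x : G) : ind A x ≤ 1 :=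
  Set.indicator_le_self' (fun _ _ => zero_le_one) x

theorem unif_nonneg (A : Finset G) (x : G) : 0 ≤ unif A x :=
  div_nonneg (ind_nonneg A x) (Nat.cast_nonneg _)

theorem le_supNorm [Finite G] (f : G → ℝ) (x : G) : f x ≤ supNorm f :=
  (le_abs_self _).trans (le_ciSup (f := fun x => |f x|) (Set.finite_range _).bddAbove x)

section

variable [Fintype G]

theorem sum_ind_mul (A : Finset G) (f : G → ℝ) : ∑ x, ind A x * f x = ∑ x ∈ A, f x := by
  rw [← sum_subset (subset_univ A) fun x _ hx => by rw [ind_of_notMem hx, zero_mul]]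
  exact sum_congr rfl fun x hx => by rw [ind_of_mem hx, one_mul]

theorem sum_ind (A : Finset G) : ∑ x, ind A x = #A := by
  simpa using sum_ind_mul A 1

theorem sum_unif_mul (A : Finset G) (f : G → ℝ) : ∑ x, unif A x * f x = (∑ x ∈ A, f x) / #A := by
  simp only [unif, div_mul_eq_mul_div, ← sum_div, sum_ind_mul]

theorem sum_unif (hA : A.Nonempty) : ∑ x, unif A x = 1 := by
  have hA0 : (#A : ℝ) ≠ 0 := Nat.cast_ne_zero.2 hA.card_pos.ne'
  simp only [unif, ← sum_div, sum_ind, div_self hA0]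

end

variable [AddCommGroup G] [Fintype G]

theorem conv_eq_sum_sub (f g : G → ℝ) (x : G) : conv f g x = ∑ y, g y * f (x - y) :=
  Fintype.sum_equiv (Equiv.subLeft x) _ _ fun y => by simp [mul_comm]

theorem conv_unif (f : G → ℝ) (A : Finset G) (x : G) :
    conv f (unif A) x = (∑ a ∈ A, f (x - a)) / #A := by
  rw [conv_eq_sum_sub, sum_unif_mul]

theorem conv_nonneg {f g : G → ℝ} (hf : ∀ x, 0 ≤ f x) (hg : ∀ x, 0 ≤ g x) (x : G) :
    0 ≤ conv f g x :=
  sum_nonneg fun _ _ => mul_nonneg (hf _) (hg _)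

theorem sum_conv (f g : G → ℝ) : ∑ x, conv f g x = (∑ x, f x) * ∑ x, g x := by
  simp only [conv]
  rw [sum_comm, sum_mul]
  refine sum_congr rfl fun y _ => ?_
  rw [← mul_sum]
  exact congrArg (f y * ·) ((Equiv.subRight y).sum_comp g)

/-- The function `f * ν * ⋯ * ν` with `n` factors `ν`. -/
def convIter (ν : G → ℝ) (n : ℕ) (f : G → ℝ) : G → ℝ := (fun g => conv g ν)^[n] f

theorem convIter_zero (ν f : G → ℝ) : convIter ν 0 f = f := rfl

theorem convIter_succ (ν : G → ℝ) (n : ℕ) (f : G → ℝ) :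
    convIter ν (n + 1) f = conv (convIter ν n f) ν :=
  Function.iterate_succ_apply' _ _ _

end Convolution

section FourierTransform

variable {G : Type*} [AddCommGroup G] [Fintype G]

/-- The Fourier transform `γ ↦ ∑ x, f x * γ x` of a real function on a finite abelian group,
normalised by the counting measure and without conjugating the characters. -/
noncomputable def dft (f : G → ℝ) (γ : AddChar G ℂ) : ℂ := ∑ x, (f x : ℂ) * γ x

theorem dft_conv (f g : G → ℝ) (γ : AddChar G ℂ) : dft (conv f g) γ = dft f γ * dft g γ := by
  simp only [dft, conv, Complex.ofReal_sum, Complex.ofReal_mul, sum_mul_sum]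
  simp only [sum_mul]
  rw [sum_comm]
  refine sum_congr rfl fun y _ => Fintype.sum_equiv (Equiv.subRight y) _ _ fun x => ?_
  have hγ : γ x = γ y * γ (x - y) := by rw [← AddChar.map_add_eq_mul, add_sub_cancel]
  rw [Equiv.subRight_apply, hγ]
  ring

theorem dft_convIter (ν : G → ℝ) (n : ℕ) (f : G → ℝ) (γ : AddChar G ℂ) :
    dft (convIter ν n f) γ = dft f γ * dft ν γ ^ n := by
  induction n with
  | zero => rw [convIter_zero, pow_zero, mul_one]
  | succ n ih => rw [convIter_succ, dft_conv, ih, pow_succ, mul_assoc]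

theorem dft_sub (f g : G → ℝ) (γ : AddChar G ℂ) : dft (f - g) γ = dft f γ - dft g γ := by
  simp [dft, sub_mul]

theorem dft_const_mul (c : ℝ) (f : G → ℝ) (γ : AddChar G ℂ) :
    dft (fun x => c * f x) γ = c * dft f γ := by
  simp [dft, mul_sum, mul_assoc]

theorem dft_unif (A : Finset G) (γ : AddChar G ℂ) : dft (unif A) γ = dft (ind A) γ / #A := by
  simp [dft, unif, sum_div, div_mul_eq_mul_div]

theorem dft_ind (A : Finset G) (γ : AddChar G ℂ) : dft (ind A) γ = ∑ x ∈ A, γ x := by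
  rw [dft, ← sum_subset (subset_univ A) fun x _ hx => by simp [ind_of_notMem hx]]
  exact sum_congr rfl fun x hx => by simp [ind_of_mem hx]

theorem norm_dft_le {f : G → ℝ} (hf : ∀ x, 0 ≤ f x) (γ : AddChar G ℂ) : ‖dft f γ‖ ≤ ∑ x, f x :=
  (norm_sum_le _ _).trans (sum_le_sum fun x _ => by simp [abs_of_nonneg (hf x)])

theorem norm_dft_unif_le_one (A : Finset G) (γ : AddChar G ℂ) : ‖dft (unif A) γ‖ ≤ 1 := by
  rcases A.eq_empty_or_nonempty with rfl | hA
  · simp [dft, unif]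
  · exact (norm_dft_le (unif_nonneg A) γ).trans (sum_unif hA).le

theorem dft_inversion (f : G → ℝ) (x : G) :
    (f x : ℂ) = (Fintype.card G : ℂ)⁻¹ * ∑ γ : AddChar G ℂ, dft f γ * γ (-x) := by
  classical
  have hsum (y : G) : ∑ γ : AddChar G ℂ, (f y : ℂ) * γ y * γ (-x) =
      if y = x then (f y : ℂ) * Fintype.card G else 0 := by
    simp_rw [mul_assoc, ← AddChar.map_add_eq_mul, ← sub_eq_add_neg, ← mul_sum,
      AddChar.sum_apply_eq_ite, sub_eq_zero, mul_ite, mul_zero]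
  have hG : (Fintype.card G : ℂ) ≠ 0 := Nat.cast_ne_zero.2 Fintype.card_ne_zero
  simp only [dft, sum_mul]
  rw [sum_comm, sum_congr rfl fun y _ => hsum y, sum_ite_eq' univ x, if_pos (mem_univ x),
    mul_comm (f x : ℂ), inv_mul_cancel_left₀ hG]

theorem dft_injective : Function.Injective (dft (G := G)) := by
  intro f g h
  funext x
  exact_mod_cast (dft_inversion f x).trans (h ▸ (dft_inversion g x).symm)

theorem conj_dft (f : G → ℝ) (γ : AddChar G ℂ) :
    starRingEnd ℂ (dft f γ) = ∑ x, (f x : ℂ) * γ (-x) := by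
  simp only [dft, map_sum, map_mul, Complex.conj_ofReal, AddChar.map_neg_eq_conj]

theorem sum_norm_dft_sq (f : G → ℝ) :
    ∑ γ : AddChar G ℂ, ‖dft f γ‖ ^ 2 = Fintype.card G * ∑ x, f x ^ 2 := by
  have hG : (Fintype.card G : ℂ) ≠ 0 := Nat.cast_ne_zero.2 Fintype.card_ne_zero
  suffices h : ∑ γ : AddChar G ℂ, ((‖dft f γ‖ : ℂ)) ^ 2 = Fintype.card G * ∑ x, (f x : ℂ) ^ 2 by
    exact_mod_cast h
  calc ∑ γ : AddChar G ℂ, ((‖dft f γ‖ : ℂ)) ^ 2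
      = ∑ γ : AddChar G ℂ, ∑ x, (f x : ℂ) * (dft f γ * γ (-x)) := by
        refine sum_congr rfl fun γ _ => ?_
        rw [← Complex.mul_conj', conj_dft, mul_sum]
        exact sum_congr rfl fun x _ => mul_left_comm _ _ _
    _ = ∑ x, (f x : ℂ) * ∑ γ : AddChar G ℂ, dft f γ * γ (-x) := by
        rw [sum_comm]
        simp only [mul_sum]
    _ = Fintype.card G * ∑ x, (f x : ℂ) ^ 2 := by
        rw [mul_sum]
        refine sum_congr rfl fun x _ => ?_
        rw [← (eq_inv_mul_iff_mul_eq₀ hG).1 (dft_inversion f x)]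
        ring

theorem abs_le_of_norm_dft_le {A : Finset G} (hA : A.Nonempty) {g : G → ℝ} {ε : ℝ}
    (h : ∀ γ, ‖dft g γ‖ ≤ ε * (‖dft (ind A) γ‖ ^ 2 / #A)) (x : G) : |g x| ≤ ε := by
  have hG : (0 : ℝ) < Fintype.card G := Nat.cast_pos.2 Fintype.card_pos
  have hA0 : (#A : ℝ) ≠ 0 := Nat.cast_ne_zero.2 hA.card_pos.ne'
  have hsq : ∑ x, ind A x ^ 2 = #A := by
    simp_rw [sq, sum_ind_mul]
    rw [sum_congr rfl fun x hx => ind_of_mem hx, sum_const, nsmul_one]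
  rw [← Real.norm_eq_abs, ← Complex.norm_real, dft_inversion g x, norm_mul, norm_inv,
    Complex.norm_natCast, inv_mul_le_iff₀ hG]
  calc ‖∑ γ : AddChar G ℂ, dft g γ * γ (-x)‖ ≤ ∑ γ : AddChar G ℂ, ‖dft g γ‖ :=
        (norm_sum_le _ _).trans (sum_le_sum fun γ _ => by simp)
    _ ≤ ∑ γ : AddChar G ℂ, ε * (‖dft (ind A) γ‖ ^ 2 / #A) := sum_le_sum fun γ _ => h γ
    _ = Fintype.card G * ε := by
        rw [← mul_sum, ← sum_div, sum_norm_dft_sq, hsq, mul_div_assoc, div_self hA0, mul_one,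
          mul_comm]

end FourierTransform

section Sampling

variable {ι : Type*} {A : Finset ι} {φ : ι → ℝ} {s δ : ℝ}

theorem exp_mul_le_one_add {t : ℝ} (hs : |s| ≤ 1) (h0 : 0 ≤ t) (h1 : t ≤ 1) :
    Real.exp (s * t) ≤ 1 + (s + s ^ 2) * t := by
  have hexp : Real.exp s - 1 ≤ s + s ^ 2 := by
    linarith [(abs_le.1 (Real.abs_exp_sub_one_sub_id_le hs)).2]
  have hconv := convexOn_exp.2 (Set.mem_univ 0) (Set.mem_univ s) (sub_nonneg.2 h1) h0
    (sub_add_cancel 1 t)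
  simp only [smul_eq_mul, mul_zero, zero_add, Real.exp_zero, mul_one] at hconv
  rw [mul_comm s]
  nlinarith

theorem sum_exp_mul_le (hA : A.Nonempty) (h0 : ∀ a ∈ A, 0 ≤ φ a) (h1 : ∀ a ∈ A, φ a ≤ 1)
    (hs : |s| ≤ 1) :
    ∑ a ∈ A, Real.exp (s * φ a) ≤ #A * Real.exp ((s + s ^ 2) * ((∑ a ∈ A, φ a) / #A)) := by
  have hA0 : (#A : ℝ) ≠ 0 := Nat.cast_ne_zero.2 hA.card_pos.ne'
  calc ∑ a ∈ A, Real.exp (s * φ a) ≤ ∑ a ∈ A, (1 + (s + s ^ 2) * φ a) :=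
        sum_le_sum fun a ha => exp_mul_le_one_add hs (h0 a ha) (h1 a ha)
    _ = #A * ((s + s ^ 2) * ((∑ a ∈ A, φ a) / #A) + 1) := by
        rw [sum_add_distrib, ← mul_sum, sum_const, nsmul_one]
        field_simp
        ring
    _ ≤ #A * Real.exp ((s + s ^ 2) * ((∑ a ∈ A, φ a) / #A)) := by
        gcongr
        exact Real.add_one_le_exp _

theorem sum_piFinset_exp_mul_le (hA : A.Nonempty) (h0 : ∀ a ∈ A, 0 ≤ φ a)
    (h1 : ∀ a ∈ A, φ a ≤ 1) (hs : |s| ≤ 1) (k : ℕ) :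
    ∑ a ∈ Fintype.piFinset fun _ : Fin k => A, Real.exp (s * ∑ i, φ (a i)) ≤
      (#A : ℝ) ^ k * Real.exp (k * ((s + s ^ 2) * ((∑ a ∈ A, φ a) / #A))) := by
  have hprod : ∑ a ∈ Fintype.piFinset fun _ : Fin k => A, Real.exp (s * ∑ i, φ (a i)) =
      (∑ a ∈ A, Real.exp (s * φ a)) ^ k := by
    simp_rw [mul_sum, Real.exp_sum]
    rw [sum_prod_piFinset A fun (_ : Fin k) a => Real.exp (s * φ a), prod_const, card_univ,
      Fintype.card_fin]
  rw [hprod, Real.exp_nat_mul, ← mul_pow]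
  exact pow_le_pow_left₀ (sum_nonneg fun _ _ => (Real.exp_pos _).le)
    (sum_exp_mul_le hA h0 h1 hs) k

theorem sum_piFinset_exp_sub_le (hA : A.Nonempty) (h0 : ∀ a ∈ A, 0 ≤ φ a)
    (h1 : ∀ a ∈ A, φ a ≤ 1) (hs : |s| = δ) (hδ : δ ≤ 1) (k : ℕ) (α : ℝ) :
    ∑ a ∈ Fintype.piFinset fun _ : Fin k => A, Real.exp (s * (∑ i, φ (a i)) -
        k * (s * ((∑ a ∈ A, φ a) / #A) + δ ^ 2 * (α + (∑ a ∈ A, φ a) / #A))) ≤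
      Real.exp (-(k * (δ ^ 2 * α))) * (#A : ℝ) ^ k := by
  have h := sum_piFinset_exp_mul_le hA h0 h1 (hs.trans_le hδ) k
  simp_rw [Real.exp_sub, ← sum_div]
  rw [div_le_iff₀ (Real.exp_pos _)]
  refine h.trans_eq ?_
  rw [mul_comm (Real.exp _) (_ ^ k), mul_assoc, ← Real.exp_add, ← hs, sq_abs]
  congr 2
  ring

theorem one_le_exp_add_exp_of_lt_abs {x p c k : ℝ} (hk : 0 < k) (hδ : 0 ≤ δ)
    (h : c < |x / k - p|) :
    1 ≤ Real.exp (δ * x - k * (δ * p + δ * c)) + Real.exp (-δ * x - k * (-δ * p + δ * c)) := by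
  obtain ⟨y, rfl⟩ : ∃ y, x = k * y := ⟨x / k, (mul_div_cancel₀ x hk.ne').symm⟩
  rw [mul_div_cancel_left₀ y hk.ne', lt_abs] at h
  rcases h with h | h
  · refine le_add_of_le_of_nonneg (Real.one_le_exp ?_) (Real.exp_pos _).le
    linarith [mul_nonneg (mul_nonneg hk.le hδ) (sub_nonneg.2 h.le)]
  · refine le_add_of_nonneg_of_le (Real.exp_pos _).le (Real.one_le_exp ?_)
    linarith [mul_nonneg (mul_nonneg hk.le hδ) (sub_nonneg.2 h.le)]

open Classical in
/- A multiplicative Chernoff bound: the error is allowed to grow with the mean. -/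
theorem card_piFinset_lt_abs_sub_le (hA : A.Nonempty) (h0 : ∀ a ∈ A, 0 ≤ φ a)
    (h1 : ∀ a ∈ A, φ a ≤ 1) (hδ0 : 0 ≤ δ) (hδ1 : δ ≤ 1) {k : ℕ} (hk : 0 < k) (α : ℝ) :
    (#{a ∈ Fintype.piFinset fun _ : Fin k => A | δ * (α + (∑ a ∈ A, φ a) / #A) <
        |(∑ i, φ (a i)) / k - (∑ a ∈ A, φ a) / #A|} : ℝ) ≤
      2 * Real.exp (-(k * (δ ^ 2 * α))) * (#A : ℝ) ^ k := by
  rw [card_filter, Nat.cast_sum, two_mul, add_mul]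
  refine le_trans (sum_le_sum fun a _ => ?_) (sum_add_distrib.trans_le
    (add_le_add (sum_piFinset_exp_sub_le hA h0 h1 (abs_of_nonneg hδ0) hδ1 k α)
      (sum_piFinset_exp_sub_le hA h0 h1 ((abs_neg δ).trans (abs_of_nonneg hδ0)) hδ1 k α)))
  split_ifs with h
  · rw [Nat.cast_one, sq, mul_assoc]
    exact one_le_exp_add_exp_of_lt_abs (Nat.cast_pos.2 hk) hδ0 h
  · rw [Nat.cast_zero]
    positivity

end Sampling

section AlmostPeriods

open Classical in
theorem card_le_two_mul_card_filter {ι κ : Type*} {Ω : Finset ι} {X : Finset κ}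
    {r : ι → κ → Prop} {β : ℝ} (hβ : 0 < β) (h : ∀ x ∈ X, (#{a ∈ Ω | r a x} : ℝ) ≤ β / 2 * #Ω) :
    (#Ω : ℝ) ≤ 2 * #{a ∈ Ω | (#{x ∈ X | r a x} : ℝ) ≤ β * #X} := by
  rcases X.eq_empty_or_nonempty with rfl | hX
  · simpa using le_mul_of_one_le_left (Nat.cast_nonneg #Ω) one_le_two
  have hX0 : (0 : ℝ) < #X := Nat.cast_pos.2 hX.card_pos
  have hsplit := card_filter_add_card_filter_not (s := Ω) fun a => (#{x ∈ X | r a x} : ℝ) ≤ β * #X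
  set bad := {a ∈ Ω | ¬ (#{x ∈ X | r a x} : ℝ) ≤ β * #X}
  have hdouble : #bad * (β * #X) ≤ #Ω / 2 * (β * #X) := by
    calc #bad * (β * #X) = ∑ _ ∈ bad, β * #X := by rw [sum_const, nsmul_eq_mul]
      _ ≤ ∑ a ∈ bad, (#{x ∈ X | r a x} : ℝ) :=
          sum_le_sum fun _ ha => (not_le.1 (mem_filter.1 ha).2).le
      _ ≤ ∑ a ∈ Ω, (#{x ∈ X | r a x} : ℝ) :=
          sum_le_sum_of_subset_of_nonneg (filter_subset _ _) fun _ _ _ => Nat.cast_nonneg _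
      _ = ∑ x ∈ X, (#{a ∈ Ω | r a x} : ℝ) := by
          exact_mod_cast sum_card_bipartiteAbove_eq_sum_card_bipartiteBelow r
      _ ≤ ∑ x ∈ X, β / 2 * #Ω := sum_le_sum h
      _ = #Ω / 2 * (β * #X) := by rw [sum_const, nsmul_eq_mul]; ring
  have hhalf := le_of_mul_le_mul_right hdouble (mul_pos hβ hX0)
  rify at hsplit
  linarith

theorem exists_card_mul_card_le {ι V : Type*} [AddGroup V] [DecidableEq V] {L t : Finset V}
    {S : Finset ι} {φ : ι → V} (h : ∀ v ∈ L, ∀ s ∈ S, v + φ s ∈ t) :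
    ∃ b, #L * #S ≤ #t * #{s ∈ S | b - φ s ∈ L} := by
  rcases (L ×ˢ S).eq_empty_or_nonempty with hempty | ⟨⟨v, s⟩, hvs⟩
  · exact ⟨0, by simp [← card_product, hempty]⟩
  have hfiber (s : ι) (hs : s ∈ S) : #{b ∈ t | b - φ s ∈ L} = #L := by
    symm
    refine card_bij (fun v _ => v + φ s) (fun v hv => ?_) (fun _ _ _ _ h => add_right_cancel h)
      fun b hb => ⟨b - φ s, (mem_filter.1 hb).2, sub_add_cancel _ _⟩
    rw [mem_filter, add_sub_cancel_right]
    exact ⟨h v hv s hs, hv⟩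
  have hdouble : ∑ b ∈ t, #{s ∈ S | b - φ s ∈ L} = #L * #S := by
    calc ∑ b ∈ t, #{s ∈ S | b - φ s ∈ L} = ∑ s ∈ S, #{b ∈ t | b - φ s ∈ L} :=
          sum_card_bipartiteAbove_eq_sum_card_bipartiteBelow fun b s => b - φ s ∈ L
      _ = #L * #S := by rw [sum_congr rfl hfiber, sum_const, smul_eq_mul, mul_comm]
  rw [mem_product] at hvs
  obtain ⟨b, -, hb⟩ := exists_max_image t (fun b => #{s ∈ S | b - φ s ∈ L})
    ⟨_, h v hvs.1 s hvs.2⟩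
  exact ⟨b, hdouble ▸ sum_le_card_nsmul t _ _ hb⟩

open Classical in
/-- `g` agrees with `u` on `X` up to a relative error `δ`, apart from a proportion at most `β`
of exceptional points. -/
def AgreesOn {G : Type*} (X : Finset G) (δ β : ℝ) (g u : G → ℝ) : Prop :=
  (#{x ∈ X | δ * u x < |g x - u x|} : ℝ) ≤ β * #X

variable {G : Type*} [AddCommGroup G]

/- For a random sample `a₁, …, aₖ` of points of `A`, the average of the translates `1_A(x - aᵢ)`
approximates `1_A * μ_A (x)`. Good samples are so abundant that two of every dense family of
their translates coincide up to a shift, and the shifts are almost periods. -/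
theorem exists_almostPeriods [Fintype G] {A S X AS : Finset G} (hA : A.Nonempty) {α β δ K : ℝ}
    (hβ : 0 < β) (hδ0 : 0 ≤ δ) (hδ1 : δ ≤ 1) {k : ℕ} (hk : 0 < k)
    (hkβ : 2 * Real.exp (-(k * (δ ^ 2 * α))) ≤ β / 2)
    (hAS : ∀ a ∈ A, ∀ s ∈ S, a + s ∈ AS) (hK : (#AS : ℝ) ≤ K * #A) :
    ∃ T ⊆ S, (#S : ℝ) ≤ 2 * K ^ k * #T ∧ ∃ g : G → ℝ, ∀ s ∈ T,
      AgreesOn X δ β (fun x => g (x + s)) fun x => α + conv (ind A) (unif A) x := by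
  classical
  have hA0 : (0 : ℝ) < #A := Nat.cast_pos.2 hA.card_pos
  let avg (a : Fin k → G) (x : G) : ℝ := α + (∑ i, ind A (x - a i)) / k
  let u (x : G) : ℝ := α + conv (ind A) (unif A) x
  let Ω := Fintype.piFinset fun _ : Fin k => A
  let L := {a ∈ Ω | (#{x ∈ X | δ * u x < |avg a x - u x|} : ℝ) ≤ β * #X}
  have hΩ : (#Ω : ℝ) = (#A : ℝ) ^ k := by simp [Ω]
  have hL : (#A : ℝ) ^ k ≤ 2 * #L := by
    rw [← hΩ]
    refine card_le_two_mul_card_filter (r := fun a x => δ * u x < |avg a x - u x|) hβ fun x _ => ?_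
    have hcher := card_piFinset_lt_abs_sub_le hA (φ := fun a => ind A (x - a))
      (fun a _ => ind_nonneg A _) (fun a _ => ind_le_one A _) hδ0 hδ1 hk α
    simp only [← conv_unif] at hcher
    simp only [avg, u, add_sub_add_left_eq_sub, hΩ]
    exact hcher.trans (by gcongr)
  obtain ⟨b, hb⟩ := exists_card_mul_card_le (L := L) (S := S)
    (φ := fun s (_ : Fin k) => s) (t := Fintype.piFinset fun _ => AS) fun a ha s hs =>
      Fintype.mem_piFinset.2 fun i => hAS _ (Fintype.mem_piFinset.1 (mem_filter.1 ha).1 i) _ hs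
  refine ⟨{s ∈ S | (b - fun _ => s) ∈ L}, filter_subset _ _, ?_, avg b, fun s hs => ?_⟩
  · rw [Fintype.card_piFinset_const] at hb
    refine le_of_mul_le_mul_right ?_ (pow_pos hA0 k)
    rify at hb
    calc (#S : ℝ) * (#A : ℝ) ^ k ≤ #S * (2 * #L) := by gcongr
      _ = 2 * (#L * #S) := by ring
      _ ≤ 2 * ((#AS : ℝ) ^ k * #{s ∈ S | (b - fun _ => s) ∈ L}) := by gcongr
      _ ≤ 2 * ((K * #A) ^ k * #{s ∈ S | (b - fun _ => s) ∈ L}) := by gcongr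
      _ = 2 * K ^ k * #{s ∈ S | (b - fun _ => s) ∈ L} * (#A : ℝ) ^ k := by ring
  · have hshift (x : G) : avg (b - fun _ => s) x = avg b (x + s) := by
      simp only [avg, Pi.sub_apply, sub_sub_eq_add_sub, add_comm x s, add_sub_assoc]
    have hgood := (mem_filter.1 (mem_filter.1 hs).2).2
    simp only [hshift] at hgood
    exact hgood

theorem le_one_add_three_mul_of_abs_sub_le {w a b δ : ℝ} (hδ1 : δ ≤ 1 / 3)
    (ha : |w - a| ≤ δ * a) (hb : |w - b| ≤ δ * b) : b ≤ (1 + 3 * δ) * a := by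
  have hδa : 0 ≤ δ * a := (abs_nonneg _).trans ha
  have hchain : (1 - δ) * b ≤ (1 - δ) * ((1 + 3 * δ) * a) := by
    linarith [(abs_le.1 ha).2, (abs_le.1 hb).1, mul_nonneg hδa (by linarith : 0 ≤ 1 - 3 * δ)]
  exact le_of_mul_le_mul_left hchain (by linarith)

theorem AgreesOn.sum_translate_le {E X : Finset G} {u g : G → ℝ} {s s' : G} {δ β M : ℝ}
    (hδ0 : 0 ≤ δ) (hδ1 : δ ≤ 1 / 3) (hu0 : ∀ x, 0 ≤ u x) (huM : ∀ x, u x ≤ M)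
    (hs : AgreesOn X δ β (fun x => g (x + s)) u) (hs' : AgreesOn X δ β (fun x => g (x + s')) u)
    (hE : E ⊆ X) (hE' : ∀ x ∈ E, x + (s - s') ∈ X) :
    ∑ x ∈ E, u (x + (s - s')) ≤ (1 + 3 * δ) * ∑ x ∈ E, u x + 2 * β * #X * M := by
  classical
  have hM : 0 ≤ M := (hu0 0).trans (huM 0)
  let P (t x : G) : Prop := δ * u x < |g (x + t) - u x|
  have hP : (#{x ∈ E | P s x} : ℝ) ≤ β * #X :=
    le_trans (mod_cast card_le_card (filter_subset_filter _ hE)) hs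
  have hP' : (#{x ∈ E | P s' (x + (s - s'))} : ℝ) ≤ β * #X := by
    refine le_trans (Nat.cast_le.2 ?_) hs'
    refine card_le_card_of_injOn (· + (s - s')) (fun x hx => ?_) (add_left_injective _).injOn
    obtain ⟨hxE, hxP⟩ := mem_filter.1 hx
    exact mem_filter.2 ⟨hE' x hxE, hxP⟩
  have hpoint (x : G) : u (x + (s - s')) ≤
      (1 + 3 * δ) * u x + ((if P s x then M else 0) + if P s' (x + (s - s')) then M else 0) := by
    have hux : 0 ≤ (1 + 3 * δ) * u x := mul_nonneg (by linarith) (hu0 x)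
    by_cases hx : P s x
    · rw [if_pos hx]
      split_ifs <;> linarith [huM (x + (s - s'))]
    by_cases hy : P s' (x + (s - s'))
    · rw [if_neg hx, if_pos hy]
      linarith [huM (x + (s - s'))]
    rw [if_neg hx, if_neg hy, add_zero, add_zero]
    have hshift : x + (s - s') + s' = x + s := by abel
    simp only [P, not_lt, hshift] at hx hy
    exact le_one_add_three_mul_of_abs_sub_le hδ1 hx hy
  calc ∑ x ∈ E, u (x + (s - s'))
      ≤ ∑ x ∈ E, ((1 + 3 * δ) * u x +
          ((if P s x then M else 0) + if P s' (x + (s - s')) then M else 0)) :=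
        sum_le_sum fun x _ => hpoint x
    _ = (1 + 3 * δ) * ∑ x ∈ E, u x +
          (#{x ∈ E | P s x} * M + #{x ∈ E | P s' (x + (s - s'))} * M) := by
        simp only [sum_add_distrib, ← mul_sum, ← sum_filter, sum_const, nsmul_eq_mul]
    _ ≤ (1 + 3 * δ) * ∑ x ∈ E, u x + (β * #X * M + β * #X * M) := by gcongr
    _ = (1 + 3 * δ) * ∑ x ∈ E, u x + 2 * β * #X * M := by ring

variable [Fintype G] {T : Finset G}

/-- The distribution `μ_T * μ_{-T}` of the difference of two independent uniform points of `T`. -/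
noncomputable def diffMeasure (T : Finset G) : G → ℝ := conv (unif T) fun x => unif T (-x)

theorem conv_diffMeasure (f : G → ℝ) (T : Finset G) (x : G) :
    conv f (diffMeasure T) x = (∑ s ∈ T, ∑ s' ∈ T, f (x + (s - s'))) / (#T : ℝ) ^ 2 := by
  have hexpand : conv f (diffMeasure T) x =
      ∑ s, unif T s * ∑ s', unif T s' * f (x + (s - s')) := by
    rw [conv_eq_sum_sub]
    simp only [diffMeasure, conv, sum_mul, mul_sum]
    rw [sum_comm]
    conv_rhs => rw [sum_comm]
    refine sum_congr rfl fun s _ => Fintype.sum_equiv (Equiv.subLeft s) _ _ fun y => ?_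
    have hshift : x + (s - y - s) = x - y := by abel
    rw [Equiv.subLeft_apply, neg_sub, hshift]
    ring
  simp only [hexpand, sum_unif_mul]
  rw [← sum_div, div_div, ← sq]

theorem dft_diffMeasure (T : Finset G) (γ : AddChar G ℂ) :
    dft (diffMeasure T) γ = (‖dft (unif T) γ‖ ^ 2 : ℝ) := by
  have hreflect : dft (fun x => unif T (-x)) γ = starRingEnd ℂ (dft (unif T) γ) := by
    rw [conj_dft]
    exact Fintype.sum_equiv (Equiv.neg G) _ _ fun x => by simp
  rw [diffMeasure, dft_conv, hreflect, Complex.mul_conj, Complex.normSq_eq_norm_sq]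

theorem le_convIter_diffMeasure (hT : T.Nonempty) {X : ℕ → Finset G}
    (hX : ∀ n, ∀ x ∈ X (n + 1), ∀ s ∈ T, ∀ s' ∈ T, x + (s - s') ∈ X n) {h : G → ℝ} {c : ℝ}
    (hc : ∀ x ∈ X 0, c ≤ h x) (n : ℕ) : ∀ x ∈ X n, c ≤ convIter (diffMeasure T) n h x := by
  induction n with
  | zero => simpa only [convIter_zero] using hc
  | succ n ih =>
    intro x hx
    rw [convIter_succ, conv_diffMeasure, le_div_iff₀ (by positivity)]
    calc c * (#T : ℝ) ^ 2 = ∑ _ ∈ T, ∑ _ ∈ T, c := by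
          simp only [sum_const, nsmul_eq_mul]
          ring
      _ ≤ ∑ s ∈ T, ∑ s' ∈ T, convIter (diffMeasure T) n h (x + (s - s')) :=
          sum_le_sum fun _ hs => sum_le_sum fun _ hs' => ih _ (hX n x hx _ hs _ hs')

theorem sum_convIter_diffMeasure_le (hT : T.Nonempty) {X : ℕ → Finset G}
    (hX0 : ∀ n, X n ⊆ X 0)
    (hX : ∀ n, ∀ x ∈ X (n + 1), ∀ s ∈ T, ∀ s' ∈ T, x + (s - s') ∈ X n)
    {u g : G → ℝ} {δ β M : ℝ} (hδ0 : 0 ≤ δ) (hδ1 : δ ≤ 1 / 3) (hβ : 0 ≤ β)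
    (hu0 : ∀ x, 0 ≤ u x) (huM : ∀ x, u x ≤ M)
    (hg : ∀ s ∈ T, AgreesOn (X 0) δ β (fun x => g (x + s)) u) (n : ℕ) :
    ∀ E ⊆ X n, ∑ x ∈ E, convIter (diffMeasure T) n u x ≤
      (1 + 3 * δ) ^ n * (∑ x ∈ E, u x + n * (2 * β * #(X 0) * M)) := by
  have hM : 0 ≤ M := (hu0 0).trans (huM 0)
  induction n with
  | zero => simp [convIter_zero]
  | succ n ih =>
    intro E hE
    set D := 2 * β * #(X 0) * M
    have hD : 0 ≤ D := by positivity
    set bound := (1 + 3 * δ) ^ (n + 1) * (∑ x ∈ E, u x + (n + 1 : ℕ) * D) with hbound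
    have htranslate (s : G) (hs : s ∈ T) (s' : G) (hs' : s' ∈ T) :
        ∑ x ∈ E, convIter (diffMeasure T) n u (x + (s - s')) ≤ bound := by
      have hE' (x : G) (hx : x ∈ E) : x + (s - s') ∈ X n := hX n x (hE hx) s hs s' hs'
      have hih := ih (E.map (addRightEmbedding (s - s'))) fun y hy => by
        obtain ⟨x, hx, rfl⟩ := mem_map.1 hy
        exact hE' x hx
      simp only [sum_map, addRightEmbedding_apply] at hih
      have hstep := (hg s hs).sum_translate_le hδ0 hδ1 hu0 huM (hg s' hs') (hE.trans (hX0 _))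
        fun x hx => hX0 n (hE' x hx)
      refine hih.trans ?_
      rw [hbound, pow_succ, mul_assoc]
      refine mul_le_mul_of_nonneg_left ?_ (by positivity)
      push_cast
      have hslack : 0 ≤ 3 * δ * ((n + 1) * D) := by positivity
      linarith
    simp only [convIter_succ, conv_diffMeasure]
    rw [← sum_div, div_le_iff₀ (by positivity), sum_comm]
    calc ∑ s ∈ T, ∑ x ∈ E, ∑ s' ∈ T, convIter (diffMeasure T) n u (x + (s - s'))
        = ∑ s ∈ T, ∑ s' ∈ T, ∑ x ∈ E, convIter (diffMeasure T) n u (x + (s - s')) :=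
          sum_congr rfl fun s _ => sum_comm
      _ ≤ ∑ _ ∈ T, ∑ _ ∈ T, bound :=
          sum_le_sum fun _ hs => sum_le_sum fun _ hs' => htranslate _ hs _ hs'
      _ = bound * (#T : ℝ) ^ 2 := by simp only [sum_const, nsmul_eq_mul]; ring

end AlmostPeriods

section Riesz

variable {G : Type*} [AddCommGroup G]

theorem norm_zpow_apply_sub_one_le [Finite G] (χ : AddChar G ℂ) (x : G) {e : ℤ}
    (he : e ∈ ({-1, 0, 1} : Finset ℤ)) : ‖(χ ^ e) x - 1‖ ≤ ‖χ x - 1‖ := by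
  simp only [mem_insert, mem_singleton] at he
  rcases he with rfl | rfl | rfl
  · rw [zpow_neg_one, AddChar.inv_apply, norm_addChar_neg_sub_one]
  · simp
  · simp

theorem norm_mul_apply_sub_one_le [Finite G] (χ ψ : AddChar G ℂ) (x : G) :
    ‖(χ * ψ) x - 1‖ ≤ ‖χ x - 1‖ + ‖ψ x - 1‖ := by
  calc ‖(χ * ψ) x - 1‖ = ‖χ x - 1 + χ x * (ψ x - 1)‖ := by
        rw [AddChar.mul_apply]
        congr 1
        ring
    _ ≤ ‖χ x - 1‖ + ‖χ x * (ψ x - 1)‖ := norm_add_le _ _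
    _ = ‖χ x - 1‖ + ‖ψ x - 1‖ := by rw [norm_mul, AddChar.norm_apply, one_mul]

theorem norm_prod_apply_sub_one_le [Finite G] {ι : Type*} (s : Finset ι) (χ : ι → AddChar G ℂ)
    (x : G) : ‖(∏ i ∈ s, χ i) x - 1‖ ≤ ∑ i ∈ s, ‖χ i x - 1‖ := by
  classical
  induction s using Finset.induction_on with
  | empty => simp
  | insert i s hi ih =>
    rw [prod_insert hi, sum_insert hi]
    exact (norm_mul_apply_sub_one_le _ _ _).trans (by gcongr)

/-- The Fourier coefficients of the Riesz factor `a + 2b Re(c χ) = a + b c χ + b c̄ χ⁻¹`, indexed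
by the exponent of `χ` in `{-1, 0, 1}`. -/
noncomputable def rieszCoeff (a b : ℝ) (c : ℂ) (e : ℤ) : ℂ :=
  if e = 0 then a else if e = 1 then b * c else b * (starRingEnd ℂ) c

theorem norm_rieszCoeff {a b : ℝ} (ha : 0 ≤ a) (hb : 0 ≤ b) {c : ℂ} (hc : ‖c‖ = 1) (e : ℤ) :
    ‖rieszCoeff a b c e‖ = if e = 0 then a else b := by
  unfold rieszCoeff
  split_ifs <;> simp [abs_of_nonneg, ha, hb, hc]

theorem sum_rieszCoeff_mul [Finite G] (a b : ℝ) (c : ℂ) (χ : AddChar G ℂ) (x : G) :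
    ∑ e ∈ ({-1, 0, 1} : Finset ℤ), rieszCoeff a b c e * (χ ^ e) x =
      (a + 2 * b * (c * χ x).re : ℝ) := by
  have hre : ((2 * (c * χ x).re : ℝ) : ℂ) = c * χ x + (starRingEnd ℂ) c * χ (-x) := by
    rw [AddChar.map_neg_eq_conj, ← map_mul, Complex.add_conj]
  have hreal : ((a + 2 * b * (c * χ x).re : ℝ) : ℂ) = a + b * ((2 * (c * χ x).re : ℝ) : ℂ) := by
    push_cast
    ring
  rw [hreal, hre, sum_insert (by decide), sum_insert (by decide), sum_singleton]
  simp [rieszCoeff]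
  ring

variable [Fintype G] {ι : Type*} [Fintype ι]

theorem sum_mul_prod_eq_sum_rieszCoeff [DecidableEq ι] (χ : ι → AddChar G ℂ) (c : ι → ℂ)
    (w : G → ℝ) (a b : ℝ) :
    ((∑ x, w x * ∏ i, (a + 2 * b * (c i * χ i x).re) : ℝ) : ℂ) =
      ∑ e ∈ Fintype.piFinset fun _ : ι => ({-1, 0, 1} : Finset ℤ),
        (∏ i, rieszCoeff a b (c i) (e i)) * dft w (∏ i, χ i ^ e i) := by
  simp only [Complex.ofReal_sum, Complex.ofReal_mul, Complex.ofReal_prod, ← sum_rieszCoeff_mul,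
    prod_univ_sum, mul_sum, dft]
  rw [sum_comm]
  refine sum_congr rfl fun e _ => sum_congr rfl fun x _ => ?_
  rw [prod_mul_distrib, AddChar.prod_apply]
  ring

theorem sum_piFinset_prod_ite [DecidableEq ι] (a b : ℝ) :
    ∑ e ∈ Fintype.piFinset fun _ : ι => ({-1, 0, 1} : Finset ℤ), ∏ i, (if e i = 0 then a else b) =
      (a + 2 * b) ^ Fintype.card ι := by
  rw [sum_prod_piFinset _ fun (_ : ι) e => if e = 0 then a else b, prod_const, card_univ,
    sum_insert (by decide), sum_insert (by decide), sum_singleton]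
  norm_num
  ring

theorem sum_mul_prod_le (χ : ι → AddChar G ℂ) (c : ι → ℂ) (hc : ∀ i, ‖c i‖ = 1) {w : G → ℝ}
    (hw0 : ∀ x, 0 ≤ w x) (hw1 : ∑ x, w x ≤ 1) {η a b : ℝ} (hη : 0 ≤ η) (ha : 0 ≤ a) (hb : 0 ≤ b)
    (h : ∀ e : ι → ℤ, (∀ i, e i ∈ ({-1, 0, 1} : Finset ℤ)) → e ≠ 0 →
      ‖dft w (∏ i, χ i ^ e i)‖ ≤ η) :
    ∑ x, w x * ∏ i, (a + 2 * b * (c i * χ i x).re) ≤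
      a ^ Fintype.card ι + (a + 2 * b) ^ Fintype.card ι * η := by
  classical
  set E := Fintype.piFinset fun _ : ι => ({-1, 0, 1} : Finset ℤ) with hE
  have hterm (e : ι → ℤ) (he : e ∈ E) :
      ‖(∏ i, rieszCoeff a b (c i) (e i)) * dft w (∏ i, χ i ^ e i)‖ ≤
        (if e = 0 then a ^ Fintype.card ι else 0) + (∏ i, if e i = 0 then a else b) * η := by
    simp only [norm_mul, norm_prod, norm_rieszCoeff ha hb (hc _)]
    have hprod : 0 ≤ ∏ i, if e i = 0 then a else b :=
      prod_nonneg fun i _ => by split_ifs <;> assumption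
    rcases eq_or_ne e 0 with rfl | he0
    · have hle : ‖dft w (∏ i, χ i ^ (0 : ι → ℤ) i)‖ ≤ 1 := (norm_dft_le hw0 _).trans hw1
      refine le_add_of_le_of_nonneg ((mul_le_of_le_one_right hprod hle).trans_eq ?_)
        (mul_nonneg hprod hη)
      simp
    · rw [if_neg he0, zero_add]
      exact mul_le_mul_of_nonneg_left (h e (fun i => Fintype.mem_piFinset.1 he i) he0) hprod
  calc ∑ x, w x * ∏ i, (a + 2 * b * (c i * χ i x).re)
      ≤ ‖((∑ x, w x * ∏ i, (a + 2 * b * (c i * χ i x).re) : ℝ) : ℂ)‖ := by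
        rw [Complex.norm_real]
        exact le_abs_self _
    _ ≤ ∑ e ∈ E, ‖(∏ i, rieszCoeff a b (c i) (e i)) * dft w (∏ i, χ i ^ e i)‖ := by
        rw [sum_mul_prod_eq_sum_rieszCoeff]
        exact norm_sum_le _ _
    _ ≤ ∑ e ∈ E, ((if e = 0 then a ^ Fintype.card ι else 0) +
          (∏ i, if e i = 0 then a else b) * η) := sum_le_sum hterm
    _ = a ^ Fintype.card ι + (a + 2 * b) ^ Fintype.card ι * η := by
        have hzero : (0 : ι → ℤ) ∈ E := by simp [hE]
        rw [sum_add_distrib, ← sum_mul, hE, sum_piFinset_prod_ite, sum_ite_eq', if_pos hzero]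

/-- The phase `c` for which `c · f̂(χ) = |f̂(χ)|`. -/
noncomputable def phase (f : G → ℝ) (χ : AddChar G ℂ) : ℂ := (starRingEnd ℂ) (dft f χ) / ‖dft f χ‖

theorem norm_phase {f : G → ℝ} {χ : AddChar G ℂ} (h : dft f χ ≠ 0) : ‖phase f χ‖ = 1 := by
  rw [phase, norm_div, RCLike.norm_conj, Complex.norm_real, norm_norm,
    div_self (norm_ne_zero_iff.2 h)]

theorem sum_mul_re_phase {f : G → ℝ} {χ : AddChar G ℂ} (h : dft f χ ≠ 0) :
    ∑ x, f x * (phase f χ * χ x).re = ‖dft f χ‖ := by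
  have hnorm : (‖dft f χ‖ : ℂ) ≠ 0 := mod_cast norm_ne_zero_iff.2 h
  have hphase : phase f χ * dft f χ = ‖dft f χ‖ := by
    rw [phase, div_mul_eq_mul_div, div_eq_iff hnorm, mul_comm, Complex.mul_conj,
      Complex.normSq_eq_norm_sq, sq, Complex.ofReal_mul]
  have hre := congrArg Complex.re hphase
  rw [Complex.ofReal_re, dft, mul_sum, Complex.re_sum] at hre
  rw [dft, ← hre]
  refine sum_congr rfl fun x _ => ?_
  rw [mul_left_comm, Complex.re_ofReal_mul]

theorem exp_sum_div_two_le (z : ι → ℂ) (hz : ∀ i, ‖z i‖ ≤ 1) :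
    Real.exp ((∑ i, (z i).re) / 2) ≤
      ∏ i, (Real.cosh (1 / 2) + 2 * (Real.sinh (1 / 2) / 2) * (z i).re) := by
  rw [sum_div, Real.exp_sum]
  refine prod_le_prod (fun i _ => (Real.exp_pos _).le) fun i _ => ?_
  have hchord := Real.exp_mul_le_cosh_add_mul_sinh ((Complex.abs_re_le_norm _).trans (hz i)) (1 / 2)
  rw [div_eq_mul_one_div]
  linarith

theorem exp_div_two_sum_le {α : Type*} [Fintype α] {T : Finset α} (hT : T.Nonempty) (F : α → ℝ) :
    Real.exp ((∑ x, unif T x * F x) / 2) ≤ ∑ x, unif T x * Real.exp (F x / 2) := by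
  have hjensen := convexOn_exp.map_sum_le (t := univ) (w := unif T) (p := fun x => F x / 2)
    (fun x _ => unif_nonneg T x) (sum_unif hT) (fun x _ => Set.mem_univ _)
  simpa only [smul_eq_mul, mul_div_assoc', ← sum_div] using hjensen

theorem cosh_half_pow_add_le (k : ℕ) :
    Real.cosh (1 / 2) ^ k +
      (Real.cosh (1 / 2) + 2 * (Real.sinh (1 / 2) / 2)) ^ k * (1 / 2) ^ k ≤
        2 * Real.exp (k / 8) := by
  have hcosh : Real.cosh (1 / 2) ≤ Real.exp (1 / 8) :=
    (Real.cosh_le_exp_half_sq _).trans (Real.exp_le_exp.2 (by norm_num))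
  have hexp : Real.exp (1 / 2) ≤ 2 :=
    (Real.le_log_iff_exp_le two_pos).1 (by linarith [Real.log_two_gt_d9])
  have hsum : Real.cosh (1 / 2) + 2 * (Real.sinh (1 / 2) / 2) = Real.exp (1 / 2) := by
    rw [← Real.cosh_add_sinh]
    ring
  have hmain : Real.cosh (1 / 2) ^ k ≤ Real.exp (k / 8) := by
    calc Real.cosh (1 / 2) ^ k ≤ Real.exp (1 / 8) ^ k :=
          pow_le_pow_left₀ (Real.cosh_pos _).le hcosh k
      _ = Real.exp (k / 8) := by rw [← Real.exp_nat_mul, mul_one_div]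
  have herror : Real.exp (1 / 2) ^ k * (1 / 2) ^ k ≤ 1 := by
    rw [← mul_pow]
    exact pow_le_one₀ (by positivity) (by linarith)
  rw [hsum]
  linarith [Real.one_le_exp (x := (k : ℝ) / 8) (by positivity)]

/- Chang's inequality by the exponential method: integrate `exp (F / 2)` with
`F = ∑ Re(cᵢ χᵢ)` against the uniform measure on `T`. By Jensen it is at least `exp (k / 4)`, while
majorising the measure by `M w` and the exponential by a Riesz product bounds it by
`2 M exp (k / 8)`. -/
theorem card_le_log_of_riesz (χ : ι → AddChar G ℂ) {T : Finset G}
    (hT : T.Nonempty) (hχ : ∀ i, 1 / 2 ≤ ‖dft (unif T) (χ i)‖) {w : G → ℝ}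
    (hw0 : ∀ x, 0 ≤ w x) (hw1 : ∑ x, w x ≤ 1) {M : ℝ} (hM : 0 < M)
    (hTw : ∀ x, unif T x ≤ M * w x)
    (h : ∀ e : ι → ℤ, (∀ i, e i ∈ ({-1, 0, 1} : Finset ℤ)) → e ≠ 0 →
      ‖dft w (∏ i, χ i ^ e i)‖ ≤ (1 / 2) ^ Fintype.card ι) :
    (Fintype.card ι : ℝ) ≤ 8 * Real.log (2 * M) := by
  set k := Fintype.card ι with hk
  have hne (i : ι) : dft (unif T) (χ i) ≠ 0 := fun h0 => by
    have := hχ i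
    rw [h0, norm_zero] at this
    linarith
  let c (i : ι) : ℂ := phase (unif T) (χ i)
  have hc (i : ι) : ‖c i‖ = 1 := norm_phase (hne i)
  let F (x : G) : ℝ := ∑ i, (c i * χ i x).re
  have hmean : (k : ℝ) / 4 ≤ (∑ x, unif T x * F x) / 2 := by
    have hswap : ∑ x, unif T x * F x = ∑ i, ‖dft (unif T) (χ i)‖ := by
      simp only [F, mul_sum]
      rw [sum_comm]
      exact sum_congr rfl fun i _ => sum_mul_re_phase (hne i)
    have hsum := card_nsmul_le_sum univ _ _ fun i _ => hχ i
    rw [nsmul_eq_mul, card_univ, ← hk] at hsum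
    linarith
  have hprod (x : G) := exp_sum_div_two_le (fun i => c i * χ i x) fun i => by simp [hc]
  have hsinh : 0 ≤ Real.sinh (1 / 2) := Real.sinh_nonneg_iff.2 (by norm_num)
  have hriesz := sum_mul_prod_le χ c hc hw0 hw1 (η := (1 / 2) ^ k) (a := Real.cosh (1 / 2))
    (b := Real.sinh (1 / 2) / 2) (by positivity) (Real.cosh_pos _).le (by linarith) h
  have hupper : Real.exp (k / 8) * Real.exp (k / 8) ≤ 2 * M * Real.exp (k / 8) := by
    calc Real.exp (k / 8) * Real.exp (k / 8) = Real.exp (k / 4) := by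
          rw [← Real.exp_add]
          congr 1
          ring
      _ ≤ Real.exp ((∑ x, unif T x * F x) / 2) := Real.exp_le_exp.2 hmean
      _ ≤ ∑ x, unif T x * Real.exp (F x / 2) := exp_div_two_sum_le hT F
      _ ≤ ∑ x, M * w x *
            ∏ i, (Real.cosh (1 / 2) + 2 * (Real.sinh (1 / 2) / 2) * (c i * χ i x).re) :=
          sum_le_sum fun x _ => mul_le_mul (hTw x) (hprod x) (Real.exp_pos _).le
            (mul_nonneg hM.le (hw0 x))
      _ ≤ M * (2 * Real.exp (k / 8)) := by
          simp only [mul_assoc M, ← mul_sum]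
          exact mul_le_mul_of_nonneg_left (hriesz.trans (cosh_half_pow_add_le k)) hM.le
      _ = 2 * M * Real.exp (k / 8) := by ring
  have hexp := le_of_mul_le_mul_right hupper (Real.exp_pos _)
  have hlog := (Real.le_log_iff_exp_le (by positivity)).2 hexp
  linarith

end Riesz

section Spectrum

variable {G : Type*} [AddCommGroup G] [Fintype G] {Γ Λ : Finset (AddChar G ℂ)} {V : Finset G}

theorem norm_dft_ind_mul_sub_one_le [DecidableEq G] (V : Finset G) (χ : AddChar G ℂ) (x : G) :
    ‖dft (ind V) χ * (χ x - 1)‖ ≤ 2 * #(V \ V.map (addRightEmbedding x)) := by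
  set W := V.map (addRightEmbedding x) with hW
  have hdiff : dft (ind V) χ * (χ x - 1) = ∑ y ∈ W \ V, χ y - ∑ y ∈ V \ W, χ y := by
    rw [sum_sdiff_sub_sum_sdiff, hW, sum_map, dft_ind, mul_sub, mul_one, sum_mul]
    congr 1
    exact sum_congr rfl fun y _ => (AddChar.map_add_eq_mul χ y x).symm
  have hsum (U : Finset G) : ‖∑ y ∈ U, χ y‖ ≤ #U := (norm_sum_le _ _).trans (by simp)
  have hcard : #(W \ V) = #(V \ W) := card_sdiff_comm (card_map _)
  have hW_le := hsum (W \ V)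
  rw [hcard] at hW_le
  rw [hdiff]
  linarith [norm_sub_le (∑ y ∈ W \ V, χ y) (∑ y ∈ V \ W, χ y), hsum (V \ W)]

theorem norm_apply_sub_one_le_of_half_lt_norm_dft {v κ : ℝ} (hv : 0 ≤ v)
    (hreg : IsRegularRadius Γ v) (hκ : 0 ≤ κ) (hκ1 : 12 * (#Γ : ℝ) * κ ≤ 1) {χ : AddChar G ℂ}
    (hχ : 1 / 2 < ‖dft (unif (bohr Γ v)) χ‖) {x : G} (hx : x ∈ bohr Γ (κ * v)) :
    ‖χ x - 1‖ ≤ 48 * #Γ * κ := by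
  classical
  set V := bohr Γ v
  have hV : (0 : ℝ) < #V := card_bohr_pos hv
  set W := V.map (addRightEmbedding x)
  have hinter : (1 - 12 * (#Γ : ℝ) * κ) * #V ≤ #(V ∩ W) := by
    refine (hreg.le_card hκ hκ1 le_rfl).trans (Nat.cast_le.2 (card_le_card fun y hy => ?_))
    refine mem_inter.2 ⟨bohr_mono (by nlinarith) hy, mem_map.2 ⟨y - x, ?_, sub_add_cancel y x⟩⟩
    refine bohr_mono (le_of_eq ?_) (sub_mem_bohr hy hx)
    ring
  have hsdiff : (#(V \ W) : ℝ) ≤ 12 * #Γ * κ * #V := by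
    have hsplit := card_inter_add_card_sdiff V W
    rify at hsplit
    linarith
  have hbound := norm_dft_ind_mul_sub_one_le V χ x
  rw [norm_mul] at hbound
  have hlarge : (#V : ℝ) / 2 ≤ ‖dft (ind V) χ‖ := by
    rw [dft_unif, norm_div, Complex.norm_natCast, lt_div_iff₀ hV] at hχ
    linarith
  refine le_of_mul_le_mul_left ?_ (half_pos hV)
  calc (#V : ℝ) / 2 * ‖χ x - 1‖ ≤ ‖dft (ind V) χ‖ * ‖χ x - 1‖ := by gcongr
    _ ≤ 2 * (12 * #Γ * κ * #V) := hbound.trans (by gcongr)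
    _ = #V / 2 * (48 * #Γ * κ) := by ring

/-- `Λ` is dissociated relative to `V` if all nontrivial combinations of its characters with
exponents in `{-1, 0, 1}` have Fourier coefficient at most `1 / 2` on `V`. -/
def RelDissociated (V : Finset G) (Λ : Finset (AddChar G ℂ)) : Prop :=
  ∀ e : AddChar G ℂ → ℤ, (∀ χ, e χ ∈ ({-1, 0, 1} : Finset ℤ)) → (∃ χ ∈ Λ, e χ ≠ 0) →
    ‖dft (unif V) (∏ χ ∈ Λ, χ ^ e χ)‖ ≤ 1 / 2

theorem relDissociated_empty (V : Finset G) : RelDissociated V ∅ :=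
  fun _ _ ⟨χ, hχ, _⟩ => absurd hχ (notMem_empty χ)

theorem RelDissociated.norm_dft_prod_le (h : RelDissociated V Λ) {Λ' : Finset (AddChar G ℂ)}
    (hsub : Λ' ⊆ Λ) {e : Λ' → ℤ} (he : ∀ χ, e χ ∈ ({-1, 0, 1} : Finset ℤ)) (he0 : e ≠ 0) :
    ‖dft (unif V) (∏ χ : Λ', χ.1 ^ e χ)‖ ≤ 1 / 2 := by
  classical
  let e' (χ : AddChar G ℂ) : ℤ := if hχ : χ ∈ Λ' then e ⟨χ, hχ⟩ else 0
  have he' (χ : Λ') : e' χ = e χ := dif_pos χ.2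
  have hprod : ∏ χ : Λ', χ.1 ^ e χ = ∏ χ ∈ Λ, χ ^ e' χ := by
    rw [← prod_subset hsub fun χ _ hχ => by simp [e', hχ], ← prod_coe_sort Λ']
    exact prod_congr rfl fun χ _ => by rw [he']
  obtain ⟨χ, hχ⟩ := Function.ne_iff.1 he0
  rw [hprod]
  refine h e' (fun ψ => ?_) ⟨χ, hsub χ.2, by rwa [he']⟩
  by_cases hψ : ψ ∈ Λ'
  · simpa only [e', dif_pos hψ] using he ⟨ψ, hψ⟩
  · simp [e', hψ]

theorem RelDissociated.exists_half_lt_of_not_insert [DecidableEq (AddChar G ℂ)]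
    (h : RelDissociated V Λ) {γ : AddChar G ℂ} (hγ : γ ∉ Λ)
    (hinsert : ¬ RelDissociated V (insert γ Λ)) :
    ∃ e : AddChar G ℂ → ℤ, (∀ χ, e χ ∈ ({-1, 0, 1} : Finset ℤ)) ∧ e γ ≠ 0 ∧
      1 / 2 < ‖dft (unif V) (γ ^ e γ * ∏ χ ∈ Λ, χ ^ e χ)‖ := by
  simp only [RelDissociated, not_forall, not_le] at hinsert
  obtain ⟨e, he, ⟨χ, hχ, hχ0⟩, hlt⟩ := hinsert
  rw [prod_insert hγ] at hlt
  refine ⟨e, he, fun hγ0 => ?_, hlt⟩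
  rw [hγ0, zpow_zero, one_mul] at hlt
  have hχΛ : χ ∈ Λ := mem_of_mem_insert_of_ne hχ fun heq => hχ0 (heq ▸ hγ0)
  exact hlt.not_ge (h e he ⟨χ, hχΛ, hχ0⟩)

theorem le_convIter_unif (hV : V.Nonempty) {X : ℕ → Finset G}
    (hX : ∀ n, ∀ x ∈ X (n + 1), ∀ v ∈ V, x - v ∈ X n) {h : G → ℝ} {c : ℝ}
    (hc : ∀ x ∈ X 0, c ≤ h x) (n : ℕ) : ∀ x ∈ X n, c ≤ convIter (unif V) n h x := by
  induction n with
  | zero => simpa only [convIter_zero] using hc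
  | succ n ih =>
    intro x hx
    rw [convIter_succ, conv_unif, le_div_iff₀ (Nat.cast_pos.2 hV.card_pos), mul_comm,
      ← nsmul_eq_mul]
    exact card_nsmul_le_sum _ _ _ fun v hv => ih _ (hX n x hx v hv)

theorem convIter_unif_nonneg (V : Finset G) (n : ℕ) {f : G → ℝ} (hf : ∀ x, 0 ≤ f x) :
    ∀ x, 0 ≤ convIter (unif V) n f x := by
  induction n with
  | zero => exact hf
  | succ n ih =>
    rw [convIter_succ]
    exact conv_nonneg ih (unif_nonneg V)

theorem sum_convIter_unif (hV : V.Nonempty) (n : ℕ) (f : G → ℝ) :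
    ∑ x, convIter (unif V) n f x = ∑ x, f x := by
  induction n with
  | zero => rfl
  | succ n ih => rw [convIter_succ, sum_conv, sum_unif hV, mul_one, ih]

theorem unif_le_mul_convIter_unif_bohr {σ v : ℝ} (hσ : 0 ≤ σ) (hv : 0 ≤ v) {T : Finset G}
    (hTS : T ⊆ bohr Γ σ) {R : ℕ}
    (hS : (#(bohr Γ (σ + R * v)) : ℝ) ≤ 2 * #(bohr Γ σ)) (x : G) :
    unif T x ≤ 2 * (#(bohr Γ σ) / #T) *
      convIter (unif (bohr Γ v)) R (unif (bohr Γ (σ + R * v))) x := by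
  set P := bohr Γ (σ + R * v) with hP
  have hP0 : (0 : ℝ) < #P := card_bohr_pos (by positivity)
  have hS0 : (0 : ℝ) < #(bohr Γ σ) := card_bohr_pos hσ
  by_cases hx : x ∈ T
  · have hconv : 1 / (#P : ℝ) ≤ convIter (unif (bohr Γ v)) R (unif P) x := by
      refine le_convIter_unif (bohr_nonempty hv) (X := fun n => bohr Γ (σ + (R - n) * v))
        (fun n y hy u hu => ?_) (fun y hy => ?_) R x (by simpa using hTS hx)
      · refine bohr_mono (le_of_eq ?_) (sub_mem_bohr hy hu)
        push_cast
        ring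
      · have hyP : y ∈ P := by simpa [hP] using hy
        rw [unif, ind_of_mem hyP]
    calc unif T x = 2 * (#(bohr Γ σ) / #T) * (1 / (2 * #(bohr Γ σ))) := by
          rw [unif, ind_of_mem hx]
          field_simp
      _ ≤ 2 * (#(bohr Γ σ) / #T) * (1 / #P) := by gcongr
      _ ≤ 2 * (#(bohr Γ σ) / #T) * convIter (unif (bohr Γ v)) R (unif P) x := by gcongr
  · rw [unif, ind_of_notMem hx, zero_div]
    exact mul_nonneg (by positivity) (convIter_unif_nonneg _ _ (unif_nonneg P) x)

theorem RelDissociated.card_lt {σ v : ℝ} (hσ : 0 ≤ σ) (hv : 0 ≤ v)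
    {T : Finset G} (hT : T.Nonempty) (hTS : T ⊆ bohr Γ σ) {R : ℕ}
    (hR : 8 * Real.log (4 * (#(bohr Γ σ) / #T)) < R)
    (hS : (#(bohr Γ (σ + R * v)) : ℝ) ≤ 2 * #(bohr Γ σ))
    (hΛ : RelDissociated (bohr Γ v) Λ) (hspec : ∀ χ ∈ Λ, 1 / 2 ≤ ‖dft (unif T) χ‖) :
    #Λ < R := by
  classical
  by_contra! hcard
  obtain ⟨Λ', hsub, hcard'⟩ := exists_subset_card_eq hcard
  have hcardΛ' : Fintype.card Λ' = R := by rw [Fintype.card_coe, hcard']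
  have hS0 : (0 : ℝ) < #(bohr Γ σ) := card_bohr_pos hσ
  set P := bohr Γ (σ + R * v)
  set w := convIter (unif (bohr Γ v)) R (unif P) with hw
  have hw1 : ∑ x, w x = 1 := by
    rw [hw, sum_convIter_unif (bohr_nonempty hv), sum_unif (bohr_nonempty (by positivity))]
  have hle := card_le_log_of_riesz (ι := Λ') (fun χ => χ.1) hT (fun χ => hspec χ (hsub χ.2))
    (convIter_unif_nonneg _ _ (unif_nonneg P)) hw1.le (M := 2 * (#(bohr Γ σ) / #T))
    (by positivity) (unif_le_mul_convIter_unif_bohr hσ hv hTS hS) fun e he he0 => by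
      rw [hcardΛ', dft_convIter, norm_mul, norm_pow, ← one_mul ((1 / 2 : ℝ) ^ R)]
      have hhalf := hΛ.norm_dft_prod_le hsub he he0
      gcongr
      exact norm_dft_unif_le_one _ _
  have hfour : 2 * (2 * (#(bohr Γ σ) / #T : ℝ)) = 4 * (#(bohr Γ σ) / #T) := by ring
  rw [hcardΛ', hfour] at hle
  exact hR.not_ge hle

theorem norm_apply_sub_one_le_of_half_lt_norm_dft_mul {v κ ω : ℝ} (hv : 0 ≤ v)
    (hreg : IsRegularRadius Γ v) (hκ : 0 ≤ κ) (hκ1 : 12 * (#Γ : ℝ) * κ ≤ 1)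
    {e : AddChar G ℂ → ℤ} (he : ∀ χ, e χ ∈ ({-1, 0, 1} : Finset ℤ)) {γ : AddChar G ℂ}
    (hγ : e γ ≠ 0)
    (hlt : 1 / 2 < ‖dft (unif (bohr Γ v)) (γ ^ e γ * ∏ χ ∈ Λ, χ ^ e χ)‖) {x : G}
    (hx : x ∈ bohr Γ (κ * v)) (hxΛ : ∀ χ ∈ Λ, ‖χ x - 1‖ ≤ ω) :
    ‖γ x - 1‖ ≤ #Λ * ω + 48 * #Γ * κ := by
  have hwhole := norm_apply_sub_one_le_of_half_lt_norm_dft hv hreg hκ hκ1 hlt hx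
  set ψ := ∏ χ ∈ Λ, χ ^ e χ
  have hψ : ‖ψ⁻¹ x - 1‖ ≤ #Λ * ω := by
    rw [AddChar.inv_apply, norm_addChar_neg_sub_one]
    calc ‖ψ x - 1‖ ≤ ∑ χ ∈ Λ, ‖(χ ^ e χ) x - 1‖ := norm_prod_apply_sub_one_le _ _ _
      _ ≤ #Λ • ω := sum_le_card_nsmul _ _ _ fun χ hχ =>
          (norm_zpow_apply_sub_one_le χ x (he χ)).trans (hxΛ χ hχ)
      _ = #Λ * ω := nsmul_eq_mul _ _
  have hpow : ‖(γ ^ e γ) x - 1‖ = ‖γ x - 1‖ := by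
    have heγ := he γ
    simp only [mem_insert, mem_singleton, hγ, false_or] at heγ
    rcases heγ with h | h
    · rw [h, zpow_neg_one, AddChar.inv_apply, norm_addChar_neg_sub_one]
    · rw [h, zpow_one]
  have hsplit := norm_mul_apply_sub_one_le (γ ^ e γ * ψ) ψ⁻¹ x
  rw [mul_inv_cancel_right, hpow] at hsplit
  linarith

/- Chang's theorem relative to a Bohr set. For a maximal dissociated subset `Λ` of the large
spectrum, each further character of the spectrum is, up to a combination of `Λ`, a character with
a large Fourier coefficient on `bohr Γ v`. -/
open Classical in
theorem exists_bohr_annihilating_spectrum {σ v : ℝ} (hσ : 0 ≤ σ)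
    (hv : 0 ≤ v) (hreg : IsRegularRadius Γ v) {T : Finset G} (hT : T.Nonempty)
    (hTS : T ⊆ bohr Γ σ) {R : ℕ} (hR : 8 * Real.log (4 * (#(bohr Γ σ) / #T)) < R)
    (hS : (#(bohr Γ (σ + R * v)) : ℝ) ≤ 2 * #(bohr Γ σ)) :
    ∃ Λ : Finset (AddChar G ℂ), #Λ < R ∧ ∀ γ, 1 / 2 ≤ ‖dft (unif T) γ‖ →
      ∀ κ ω : ℝ, 0 ≤ κ → 12 * (#Γ : ℝ) * κ ≤ 1 → 0 ≤ ω → ω ≤ κ * v →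
        ∀ x ∈ bohr (Γ ∪ Λ) ω, ‖γ x - 1‖ ≤ R * ω + 48 * #Γ * κ := by
  let spec : Finset (AddChar G ℂ) := {γ | 1 / 2 ≤ ‖dft (unif T) γ‖}
  obtain ⟨Λ, hΛ, hmax⟩ := exists_max_image {Λ ∈ spec.powerset | RelDissociated (bohr Γ v) Λ} card
    ⟨∅, mem_filter.2 ⟨empty_mem_powerset _, relDissociated_empty _⟩⟩
  obtain ⟨hΛspec, hΛdiss⟩ := mem_filter.1 hΛ
  rw [mem_powerset] at hΛspec
  have hcard : #Λ < R := hΛdiss.card_lt hσ hv hT hTS hR hS fun χ hχ =>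
    (mem_filter.1 (hΛspec hχ)).2
  have hcard_le : (#Λ : ℝ) ≤ R := Nat.cast_le.2 hcard.le
  refine ⟨Λ, hcard, fun γ hγ κ ω hκ hκ1 hω hωv x hx => ?_⟩
  have hxΛ (χ : AddChar G ℂ) (hχ : χ ∈ Λ) : ‖χ x - 1‖ ≤ ω :=
    mem_bohr.1 hx χ (mem_union_right _ hχ)
  by_cases hγΛ : γ ∈ Λ
  · have hR1 : (1 : ℝ) ≤ R := mod_cast (Nat.zero_le _).trans_lt hcard
    have hκΓ : 0 ≤ 48 * (#Γ : ℝ) * κ := by positivity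
    linarith [hxΛ γ hγΛ, le_mul_of_one_le_left hω hR1]
  have hinsert : ¬ RelDissociated (bohr Γ v) (insert γ Λ) := fun hd => by
    have hle := hmax (insert γ Λ) (mem_filter.2 ⟨mem_powerset.2 (insert_subset
      (mem_filter.2 ⟨mem_univ _, hγ⟩) hΛspec), hd⟩)
    rw [card_insert_of_notMem hγΛ] at hle
    exact Nat.not_succ_le_self _ hle
  obtain ⟨e, he, heγ, hlt⟩ := hΛdiss.exists_half_lt_of_not_insert hγΛ hinsert
  calc ‖γ x - 1‖ ≤ #Λ * ω + 48 * #Γ * κ :=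
        norm_apply_sub_one_le_of_half_lt_norm_dft_mul hv hreg hκ hκ1 he heγ hlt
          (bohr_mono hωv (bohr_anti subset_union_left hx)) hxΛ
    _ ≤ R * ω + 48 * #Γ * κ := by gcongr

end Spectrum

section Smoothing

variable {G : Type*} [AddCommGroup G] [Fintype G]

theorem sum_diffMeasure {T : Finset G} (hT : T.Nonempty) : ∑ x, diffMeasure T x = 1 := by
  have hneg : ∑ x, unif T (-x) = ∑ x, unif T x :=
    Fintype.sum_equiv (Equiv.neg G) _ _ fun _ => rfl
  rw [diffMeasure, sum_conv, hneg, sum_unif hT, one_mul]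

theorem convIter_const_add {ν : G → ℝ} (hν : ∑ x, ν x = 1) (a : ℝ) (f : G → ℝ) (n : ℕ) :
    convIter ν n (fun x => a + f x) = fun x => a + convIter ν n f x := by
  induction n with
  | zero => rfl
  | succ n ih =>
    funext x
    rw [convIter_succ, convIter_succ, ih, conv_eq_sum_sub, conv_eq_sum_sub]
    simp only [mul_add, sum_add_distrib]
    rw [← sum_mul, hν, one_mul]

theorem norm_one_sub_dft_unif_le {M : Finset G} (hM : M.Nonempty) {γ : AddChar G ℂ} {ζ : ℝ}
    (h : ∀ x ∈ M, ‖γ x - 1‖ ≤ ζ) : ‖1 - dft (unif M) γ‖ ≤ ζ := by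
  have hM0 : (0 : ℝ) < #M := Nat.cast_pos.2 hM.card_pos
  have hmean : 1 - dft (unif M) γ = -(∑ x ∈ M, (γ x - 1)) / #M := by
    have hM0' : (#M : ℂ) ≠ 0 := mod_cast hM0.ne'
    rw [dft_unif, dft_ind, sum_sub_distrib, sum_const, nsmul_one]
    field_simp
    ring
  rw [hmean, norm_div, norm_neg, Complex.norm_natCast, div_le_iff₀ hM0, mul_comm, ← nsmul_eq_mul]
  exact (norm_sum_le _ _).trans (sum_le_card_nsmul _ _ _ h)

theorem norm_one_sub_sq_le_two {z : ℂ} (hz : ‖z‖ ≤ 1) : ‖1 - z ^ 2‖ ≤ 2 := by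
  have hsq : ‖z ^ 2‖ ≤ 1 := by
    rw [norm_pow]
    exact pow_le_one₀ (norm_nonneg z) hz
  linarith [norm_sub_le 1 (z ^ 2), norm_one (α := ℂ)]

theorem norm_one_sub_sq_le {z : ℂ} (hz : ‖z‖ ≤ 1) : ‖1 - z ^ 2‖ ≤ 2 * ‖1 - z‖ := by
  have hadd : ‖1 + z‖ ≤ 2 := by linarith [norm_add_le 1 z, norm_one (α := ℂ)]
  calc ‖1 - z ^ 2‖ = ‖1 + z‖ * ‖1 - z‖ := by
        rw [← norm_mul]
        congr 1
        ring
    _ ≤ 2 * ‖1 - z‖ := by gcongr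

theorem abs_convIter_sub_conv_conv_le {A T M : Finset G} (hA : A.Nonempty)
    (hM : M.Nonempty) {ζ ε : ℝ} {l : ℕ}
    (hspec : ∀ γ, 1 / 2 ≤ ‖dft (unif T) γ‖ → ∀ x ∈ M, ‖γ x - 1‖ ≤ ζ)
    (hl : 2 * (1 / 4 : ℝ) ^ l ≤ ε) (hζ : 2 * ζ ≤ ε) (x : G) :
    |convIter (diffMeasure T) l (conv (ind A) (unif A)) x -
      conv (conv (convIter (diffMeasure T) l (conv (ind A) (unif A))) (unif M)) (unif M) x| ≤
      ε := by
  set F := convIter (diffMeasure T) l (conv (ind A) (unif A)) with hF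
  refine abs_le_of_norm_dft_le hA (g := F - conv (conv F (unif M)) (unif M)) (fun γ => ?_) x
  set m := dft (unif M) γ
  set t := ‖dft (unif T) γ‖
  have hfactor : dft (F - conv (conv F (unif M)) (unif M)) γ =
      ((t ^ 2 : ℝ) : ℂ) ^ l * (1 - m ^ 2) * (dft (ind A) γ ^ 2 / #A) := by
    rw [dft_sub, dft_conv, dft_conv, hF, dft_convIter, dft_conv, dft_unif A, dft_diffMeasure]
    ring
  rw [hfactor, norm_mul, norm_div, norm_pow (dft _ _), Complex.norm_natCast]
  refine mul_le_mul_of_nonneg_right ?_ (by positivity)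
  rw [norm_mul, norm_pow, Complex.norm_of_nonneg (by positivity)]
  have hm1 : ‖m‖ ≤ 1 := norm_dft_unif_le_one M γ
  by_cases hγ : 1 / 2 ≤ t
  · have ht1 : (t ^ 2) ^ l ≤ 1 :=
      pow_le_one₀ (by positivity) (pow_le_one₀ (norm_nonneg _) (norm_dft_unif_le_one T γ))
    calc (t ^ 2) ^ l * ‖1 - m ^ 2‖ ≤ 1 * (2 * ‖1 - m‖) := by
          gcongr
          exact norm_one_sub_sq_le hm1
      _ ≤ 1 * (2 * ζ) := by
          gcongr
          exact norm_one_sub_dft_unif_le hM (hspec γ hγ)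
      _ ≤ ε := by rwa [one_mul]
  · have ht2 : t ^ 2 ≤ 1 / 4 := by nlinarith [norm_nonneg (dft (unif T) γ)]
    calc (t ^ 2) ^ l * ‖1 - m ^ 2‖ ≤ (1 / 4) ^ l * 2 := by
          gcongr
          exact norm_one_sub_sq_le_two hm1
      _ ≤ ε := by rwa [mul_comm]

theorem conv_conv_convIter (ν f g : G → ℝ) (n : ℕ) :
    conv (conv (convIter ν n f) g) g = convIter ν n (conv (conv f g) g) := by
  refine dft_injective (funext fun γ => ?_)
  simp only [dft_conv, dft_convIter]
  ring

theorem conv_conv_conv_unif (A : Finset G) (g : G → ℝ) (x : G) :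
    conv (conv (conv (ind A) (unif A)) g) g x = conv (conv (ind A) g) (conv (ind A) g) x / #A := by
  have hfun : conv (conv (conv (ind A) (unif A)) g) g =
      fun x => (#A : ℝ)⁻¹ * conv (conv (ind A) g) (conv (ind A) g) x := by
    refine dft_injective (funext fun γ => ?_)
    rw [dft_const_mul]
    simp only [dft_conv, dft_unif]
    push_cast
    ring
  simp only [hfun, inv_mul_eq_div]

theorem sq_mul_sub_sub_le_mul {m a b p q t : ℝ} (hm : 0 ≤ m) (hp : p ≤ 1) (hq : q ≤ 1)
    (ha : a ≤ m * p) (hb : b ≤ m * q) (ht : t ≤ p * q) :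
    m ^ 2 * t - m * (m * p - a) - m * (m * q - b) ≤ a * b := by
  have hab := mul_nonneg (sub_nonneg.2 ha) (sub_nonneg.2 hb)
  have haq := mul_nonneg (mul_nonneg hm (sub_nonneg.2 hq)) (sub_nonneg.2 ha)
  have hbp := mul_nonneg (mul_nonneg hm (sub_nonneg.2 hp)) (sub_nonneg.2 hb)
  have htm := mul_le_mul_of_nonneg_left ht (sq_nonneg m)
  linarith

theorem le_conv_self {g : G → ℝ} {m : ℝ} (hm : 0 ≤ m) (hgm : ∀ x, g x ≤ m) {P Q : Finset G}
    (hgP : ∀ x, x ∉ P → g x = 0) (hQP : Q ⊆ P) {x : G} (hx : ∀ y ∈ Q, x - y ∈ P) :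
    m ^ 2 * #Q - 2 * m * (m * #P - ∑ y, g y) ≤ conv g g x := by
  have hg (y : G) : g y ≤ m * ind P y := by
    by_cases hy : y ∈ P
    · rw [ind_of_mem hy, mul_one]
      exact hgm y
    · rw [hgP y hy, ind_of_notMem hy, mul_zero]
  have hQ (y : G) : ind Q y ≤ ind P y * ind P (x - y) := by
    by_cases hy : y ∈ Q
    · rw [ind_of_mem hy, ind_of_mem (hQP hy), ind_of_mem (hx y hy), mul_one]
    · rw [ind_of_notMem hy]
      exact mul_nonneg (ind_nonneg _ _) (ind_nonneg _ _)
  have hreflect : ∑ y, (m * ind P (x - y) - g (x - y)) = ∑ y, (m * ind P y - g y) :=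
    Fintype.sum_equiv (Equiv.subLeft x) _ _ fun _ => rfl
  calc m ^ 2 * #Q - 2 * m * (m * #P - ∑ y, g y)
      = ∑ y, (m ^ 2 * ind Q y - m * (m * ind P y - g y) -
          m * (m * ind P (x - y) - g (x - y))) := by
        rw [sum_sub_distrib, sum_sub_distrib, ← mul_sum, ← mul_sum, ← mul_sum, hreflect,
          sum_sub_distrib, ← mul_sum, sum_ind, sum_ind]
        ring
    _ ≤ ∑ y, g y * g (x - y) := sum_le_sum fun y _ => sq_mul_sub_sub_le_mul hm
        (ind_le_one P y) (ind_le_one P (x - y)) (hg y) (hg (x - y)) (hQ y)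

end Smoothing

section Counting

variable {G : Type*} [AddCommGroup G]

/-- The part of `A - u` inside `V`. Progressions in such parts with a common `u` translate back to
progressions in `A`. -/
noncomputable def translatePart (A V : Finset G) (u : G) : Finset G :=
  open Classical in {y ∈ V | u + y ∈ A}

theorem mem_translatePart {A V : Finset G} {u y : G} :
    y ∈ translatePart A V u ↔ y ∈ V ∧ u + y ∈ A := by
  classical exact mem_filter

variable [Fintype G]

theorem conv_ind_unif_nonneg (A B : Finset G) (x : G) : 0 ≤ conv (ind A) (unif B) x :=
  conv_nonneg (ind_nonneg A) (unif_nonneg B) x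

theorem conv_ind_unif_le_one (A B : Finset G) (x : G) : conv (ind A) (unif B) x ≤ 1 := by
  rw [conv_unif]
  refine div_le_one_of_le₀ ?_ (Nat.cast_nonneg _)
  simpa using sum_le_card_nsmul B _ 1 fun a _ => ind_le_one A (x - a)

theorem sub_le_sum_conv_ind_unif_bohr {Γ : Finset (AddChar G ℂ)} {ρ r κ : ℝ}
    (hreg : IsRegularRadius Γ ρ) (hκ : 0 ≤ κ) (hκ1 : 12 * (#Γ : ℝ) * κ ≤ 1) (hr : 0 ≤ r)
    (hrκ : r ≤ κ * ρ) {A : Finset G} (hA : A ⊆ bohr Γ ρ) :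
    (#A : ℝ) - 12 * #Γ * κ * #(bohr Γ ρ) ≤
      ∑ x ∈ bohr Γ ρ, conv (ind A) (unif (bohr Γ r)) x := by
  classical
  set B := bohr Γ ρ
  set V := bohr Γ r
  set B₀ := bohr Γ ((1 - κ) * ρ)
  have hB₀B : B₀ ⊆ B := bohr_mono (by linarith)
  have hinterior : (#A : ℝ) - 12 * #Γ * κ * #B ≤ #(A ∩ B₀) := by
    have hB₀ : (1 - 12 * (#Γ : ℝ) * κ) * #B ≤ #B₀ := hreg.le_card hκ hκ1 le_rfl
    have hle : #(A \ B₀) ≤ #(B \ B₀) := card_le_card (sdiff_subset_sdiff hA Subset.rfl)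
    have hsplitA := card_inter_add_card_sdiff A B₀
    have hsplitB := card_sdiff_add_card_eq_card hB₀B
    rify at hle hsplitA hsplitB
    linarith
  have htranslate (v : G) (hv : v ∈ V) : (#(A ∩ B₀) : ℝ) ≤ ∑ x ∈ B, ind A (x - v) := by
    have hsub : (A ∩ B₀).map (addRightEmbedding v) ⊆ B := fun y hy => by
      obtain ⟨a, ha, rfl⟩ := mem_map.1 hy
      exact bohr_mono (by linarith) (add_mem_bohr (mem_inter.1 ha).2 hv)
    refine le_trans (le_of_eq ?_)
      (sum_le_sum_of_subset_of_nonneg hsub fun _ _ _ => ind_nonneg _ _)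
    simp only [sum_map, addRightEmbedding_apply, add_sub_cancel_right]
    rw [sum_congr rfl fun a ha => ind_of_mem (mem_inter.1 ha).1, sum_const, nsmul_one]
  simp only [conv_unif]
  rw [← sum_div, le_div_iff₀ (card_bohr_pos hr), sum_comm, mul_comm, ← nsmul_eq_mul]
  exact card_nsmul_le_sum _ _ _ fun v hv => hinterior.trans (htranslate v hv)

theorem card_translatePart {Γ : Finset (AddChar G ℂ)} {r : ℝ} (hr : 0 ≤ r) (A : Finset G) (u : G) :
    (#(translatePart A (bohr Γ r) u) : ℝ) =
      conv (ind A) (unif (bohr Γ r)) u * #(bohr Γ r) := by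
  classical
  rw [conv_unif, div_mul_cancel₀ _ (card_bohr_pos hr).ne', translatePart, card_filter]
  push_cast
  refine sum_nbij' Neg.neg Neg.neg (fun _ => neg_mem_bohr) (fun _ => neg_mem_bohr)
    (fun y _ => neg_neg y) (fun y _ => neg_neg y) fun y _ => ?_
  rw [sub_neg_eq_add]
  split_ifs with h
  · rw [ind_of_mem h]
  · rw [ind_of_notMem h]

theorem conv_ind_translatePart_le (A V M : Finset G) (u x : G) :
    conv (ind (translatePart A V u)) (unif M) x ≤ conv (ind A) (unif M) (u + x) := by
  rw [conv_unif, conv_unif]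
  refine div_le_div_of_nonneg_right (sum_le_sum fun a _ => ?_) (Nat.cast_nonneg _)
  by_cases h : x - a ∈ translatePart A V u
  · rw [ind_of_mem h, add_sub_assoc, ind_of_mem (mem_translatePart.1 h).2]
  · rw [ind_of_notMem h]
    exact ind_nonneg _ _

theorem card_mul_sum_conv_le_numAP (A V W : Finset G) (u : G) :
    (#(translatePart A V u) : ℝ) * ∑ b ∈ translatePart A W u,
      conv (ind (translatePart A V u)) (unif (translatePart A V u)) (2 • b) ≤ numAP A := by
  classical
  set A₁ := translatePart A V u
  set A₂ := translatePart A W u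
  rcases A₁.eq_empty_or_nonempty with hempty | hne
  · simp [hempty]
  have hcount : (#A₁ : ℝ) * ∑ b ∈ A₂, conv (ind A₁) (unif A₁) (2 • b) =
      #{q ∈ A₂ ×ˢ A₁ | 2 • q.1 - q.2 ∈ A₁} := by
    rw [card_filter, mul_sum, sum_product]
    push_cast
    refine sum_congr rfl fun b _ => ?_
    rw [conv_unif, mul_div_cancel₀ _ (Nat.cast_pos.2 hne.card_pos).ne']
    refine sum_congr rfl fun a _ => ?_
    split_ifs with h
    · exact ind_of_mem h
    · exact ind_of_notMem h
  rw [hcount, numAP, Nat.cast_le]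
  refine card_le_card_of_injOn (fun q => (u + q.2, u + q.1, u + (2 • q.1 - q.2)))
    (fun q hq => ?_) fun q _ q' _ h => ?_
  · obtain ⟨hmem, hthird⟩ := mem_filter.1 hq
    obtain ⟨hmid, hfirst⟩ := mem_product.1 hmem
    simp only [coe_filter, Set.mem_ofPred_eq, mem_product]
    refine ⟨⟨(mem_translatePart.1 hfirst).2, (mem_translatePart.1 hmid).2,
      (mem_translatePart.1 hthird).2⟩, ?_⟩
    simp only [two_nsmul]
    abel
  · simp only [Prod.mk.injEq, add_right_inj] at h
    exact Prod.ext h.2.1 h.1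

end Counting

section Parameters

variable {α : ℝ} {k l : ℕ}

theorem le_log_two_div (hα : 0 < α) (hα1 : α ≤ 1) : 69 / 100 ≤ Real.log (2 / α) := by
  have hmono : Real.log 2 ≤ Real.log (2 / α) :=
    Real.log_le_log (by norm_num) (le_div_self (by norm_num) hα hα1)
  linarith [Real.log_two_gt_d9]

theorem exp_neg_nat_mul_log_two_div (hα : 0 < α) (n : ℕ) :
    Real.exp (-(n * Real.log (2 / α))) = (α / 2) ^ n := by
  rw [← mul_neg, Real.exp_nat_mul, Real.exp_neg, Real.exp_log (by positivity), inv_div]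

theorem nat_mul_le_twenty (hα : 0 < α) (hl : l ≤ 10 * Real.log (2 / α)) : l * α ≤ 20 := by
  have hlog : Real.log (2 / α) ≤ 2 / α := Real.log_le_self (by positivity)
  calc l * α ≤ 10 * (2 / α) * α := by
        gcongr
        linarith
    _ = 20 := by
        field_simp
        norm_num

theorem exists_numFactors (hα : 0 < α) (hα1 : α ≤ 1) :
    ∃ l : ℕ, 1 ≤ l ∧ l ≤ 10 * Real.log (2 / α) ∧ 2 * (1 / 4 : ℝ) ^ l ≤ α / 20 := by
  have hL := le_log_two_div hα hα1
  set L := Real.log (2 / α)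
  have hceil := Nat.ceil_lt_add_one (show 0 ≤ 8 * L by linarith)
  refine ⟨⌈8 * L⌉₊, Nat.one_le_ceil_iff.2 (by linarith), by linarith, ?_⟩
  have hquarter : (1 / 4 : ℝ) ≤ Real.exp (-1) := by
    rw [Real.exp_neg, one_div]
    exact inv_anti₀ (Real.exp_pos _) (by linarith [Real.exp_one_lt_d9])
  have hpow : (1 / 4 : ℝ) ^ ⌈8 * L⌉₊ ≤ (α / 2) ^ 8 := by
    calc (1 / 4 : ℝ) ^ ⌈8 * L⌉₊ ≤ Real.exp (-1) ^ ⌈8 * L⌉₊ := by gcongr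
      _ = Real.exp (-⌈8 * L⌉₊) := by rw [← Real.exp_nat_mul, mul_neg_one]
      _ ≤ Real.exp (-((8 : ℕ) * L)) := Real.exp_le_exp.2 (neg_le_neg (Nat.le_ceil _))
      _ = (α / 2) ^ 8 := exp_neg_nat_mul_log_two_div hα 8
  have hα8 : α ^ 8 ≤ α := pow_le_of_le_one hα.le hα1 (by norm_num)
  rw [div_pow α] at hpow
  linarith

theorem exists_numSamples (hα : 0 < α) (hα1 : α ≤ 1) (hl1 : 1 ≤ l)
    (hl : l ≤ 10 * Real.log (2 / α)) :
    ∃ k : ℕ, 1 ≤ k ∧ 17 * Real.log (2 / α) ≤ k * ((1 / (60 * l : ℝ)) ^ 2 * α) ∧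
      k ≤ 7 * 10 ^ 6 * α⁻¹ * Real.log (2 / α) ^ 3 := by
  have hL := le_log_two_div hα hα1
  set L := Real.log (2 / α)
  have hy : 0 < 17 * L * (60 * l) ^ 2 * α⁻¹ := by positivity
  refine ⟨⌈17 * L * (60 * l) ^ 2 * α⁻¹⌉₊, Nat.ceil_pos.2 hy, ?_, ?_⟩
  · calc 17 * L = 17 * L * (60 * l) ^ 2 * α⁻¹ * ((1 / (60 * l : ℝ)) ^ 2 * α) := by field_simp
      _ ≤ _ := by
        gcongr
        exact Nat.le_ceil _
  · have hone : 3 / 10 ≤ α⁻¹ * L ^ 3 := by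
      calc (3 / 10 : ℝ) ≤ 1 * (69 / 100) ^ 3 := by norm_num
        _ ≤ α⁻¹ * L ^ 3 := by
          gcongr
          exact (one_le_inv₀ hα).2 hα1
    have hupper : 17 * L * (60 * l) ^ 2 * α⁻¹ ≤ 6120000 * (α⁻¹ * L ^ 3) := by
      calc 17 * L * (60 * l) ^ 2 * α⁻¹ ≤ 17 * L * (60 * (10 * L)) ^ 2 * α⁻¹ := by gcongr
        _ = 6120000 * (α⁻¹ * L ^ 3) := by ring
    linarith [Nat.ceil_lt_add_one hy.le]

theorem two_mul_exp_neg_le (hα : 0 < α) (hα1 : α ≤ 1) (hl1 : 1 ≤ l)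
    (hl : l ≤ 10 * Real.log (2 / α)) {x : ℝ} (hx : 17 * Real.log (2 / α) ≤ x) :
    2 * Real.exp (-x) ≤ α ^ 2 / (1000 * l) / 2 := by
  have hexp : Real.exp (-x) ≤ α ^ 3 / 131072 := by
    calc Real.exp (-x) ≤ Real.exp (-((17 : ℕ) * Real.log (2 / α))) :=
          Real.exp_le_exp.2 (neg_le_neg hx)
      _ = α ^ 17 / 131072 := by
          rw [exp_neg_nat_mul_log_two_div hα, div_pow]
          norm_num
      _ ≤ α ^ 3 / 131072 :=
          div_le_div_of_nonneg_right (pow_le_pow_of_le_one hα.le hα1 (by norm_num)) (by norm_num)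
  have hcube : α ^ 3 / 131072 * 4 ≤ α ^ 2 / (1000 * l) := by
    rw [le_div_iff₀ (by positivity)]
    linarith [mul_le_mul_of_nonneg_left (nat_mul_le_twenty hα hl) (sq_nonneg α), sq_nonneg α]
  linarith

theorem log_mul_three_div_pow_le (hα : 0 < α) (hα1 : α ≤ 1) (hk : 1 ≤ k) :
    8 * Real.log (4 * (2 * (3 / α) ^ k)) ≤ 40 * k * Real.log (2 / α) := by
  have htwo : 2 ≤ 2 / α := le_div_self (by norm_num) hα hα1
  have hbase : 3 / α ≤ (2 / α) ^ 2 := by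
    rw [div_pow, div_le_div_iff₀ hα (by positivity)]
    nlinarith
  have hle : 4 * (2 * (3 / α) ^ k) ≤ (2 / α) ^ (5 * k) := by
    calc 4 * (2 * (3 / α) ^ k) = 2 ^ 3 * (3 / α) ^ k := by ring
      _ ≤ (2 / α) ^ (3 * k) * ((2 / α) ^ 2) ^ k := by
          gcongr
          exact (pow_le_pow_left₀ (by norm_num) htwo 3).trans
            (pow_le_pow_right₀ (by linarith) (by lia))
      _ = (2 / α) ^ (5 * k) := by
          rw [← pow_mul, ← pow_add]
          congr 1
          ring
  have hlog := Real.log_le_log (by positivity) hle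
  rw [Real.log_pow] at hlog
  push_cast at hlog
  linarith

theorem exists_numSamples_rank (hα : 0 < α) (hα1 : α ≤ 1) (hl1 : 1 ≤ l)
    (hl : l ≤ 10 * Real.log (2 / α)) :
    ∃ k R : ℕ, 0 < k ∧ 1 ≤ R ∧
      2 * Real.exp (-(k * ((1 / (60 * l : ℝ)) ^ 2 * α))) ≤ α ^ 2 / (1000 * l) / 2 ∧
      8 * Real.log (4 * (2 * (3 / α) ^ k)) < R ∧
      R ≤ 3 * 10 ^ 8 * α⁻¹ * Real.log (2 / α) ^ 4 := by
  obtain ⟨k, hk1, hk, hkle⟩ := exists_numSamples hα hα1 hl1 hl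
  have hL := le_log_two_div hα hα1
  refine ⟨k, ⌈40 * k * Real.log (2 / α)⌉₊ + 1, hk1, by lia, two_mul_exp_neg_le hα hα1 hl1 hl hk,
    ?_, ?_⟩
  · rw [Nat.cast_succ]
    linarith [log_mul_three_div_pow_le hα hα1 hk1, Nat.le_ceil (40 * k * Real.log (2 / α))]
  · set L := Real.log (2 / α)
    have hone : 2 / 10 ≤ α⁻¹ * L ^ 4 := by
      calc (2 / 10 : ℝ) ≤ 1 * (69 / 100) ^ 4 := by norm_num
        _ ≤ α⁻¹ * L ^ 4 := by
          gcongr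
          exact (one_le_inv₀ hα).2 hα1
    have hupper : 40 * k * L ≤ 280000000 * (α⁻¹ * L ^ 4) := by
      calc 40 * k * L ≤ 40 * (7 * 10 ^ 6 * α⁻¹ * L ^ 3) * L := by gcongr
        _ = 280000000 * (α⁻¹ * L ^ 4) := by ring
    rw [Nat.cast_succ]
    linarith [Nat.ceil_lt_add_one (show 0 ≤ 40 * k * L by positivity)]

theorem rank_mul_pow_five_le {R : ℝ} (hα : 0 < α) (hα1 : α ≤ 1)
    (hR : R ≤ 3 * 10 ^ 8 * α⁻¹ * Real.log (2 / α) ^ 4) : R * α ^ 5 ≤ 48 * 10 ^ 8 := by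
  have hL := le_log_two_div hα hα1
  have hlog : Real.log (2 / α) ≤ 2 / α := Real.log_le_self (by positivity)
  calc R * α ^ 5 ≤ 3 * 10 ^ 8 * α⁻¹ * (2 / α) ^ 4 * α ^ 5 := by
        gcongr
        exact hR.trans (by gcongr)
    _ = 48 * 10 ^ 8 := by
        field_simp
        norm_num

theorem one_add_three_mul_pow_le (hl : 1 ≤ l) : (1 + 3 * (1 / (60 * l : ℝ))) ^ l ≤ 53 / 50 := by
  have hl0 : (0 : ℝ) < l := Nat.cast_pos.2 hl
  calc (1 + 3 * (1 / (60 * l : ℝ))) ^ l = (1 + 1 / 20 / l) ^ l := by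
        congr 2
        field_simp
        norm_num
    _ ≤ Real.exp (1 / 20 / l) ^ l := by
        gcongr
        linarith [Real.add_one_le_exp (1 / 20 / l : ℝ)]
    _ = Real.exp (1 / 20) := by
        rw [← Real.exp_nat_mul, mul_div_cancel₀ _ hl0.ne']
    _ ≤ 53 / 50 := by
        linarith [(abs_le.1 (Real.abs_exp_sub_one_sub_id_le (x := 1 / 20) (by norm_num))).2]

end Parameters

section Increment

variable {G : Type*} [AddCommGroup G] [Fintype G]

/- The function `1_A * μ_M` is at most `m = 9α/8`, with average about `13α/16` or more on `B`. Hence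
its self-convolution near the origin is at least `m² - 2m(9/8 - 13/16)α = 9α²/16` per element of
`B`, up to the boundary of `B`. -/
theorem half_le_conv_conv {Γ : Finset (AddChar G ℂ)} {r₁ r₂ κ α : ℝ} (hr₁ : 0 ≤ r₁)
    (hr₂ : 0 ≤ r₂) (hreg : IsRegularRadius Γ r₁) (hκ : 0 ≤ κ)
    (hκ1 : 12 * (#Γ : ℝ) * (6 * κ) ≤ 1 / 64) (hr : r₂ ≤ κ * r₁) (hα : 0 < α)
    {A M : Finset G} (hA : A ⊆ bohr Γ r₁) (hAc : 13 / 16 * α * #(bohr Γ r₁) ≤ #A)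
    (hMn : M.Nonempty) (hM : M ⊆ bohr Γ (2 * r₂))
    (hup : ∀ x, conv (ind A) (unif M) x < 9 / 8 * α) {x : G} (hx : x ∈ bohr Γ (4 * r₂)) :
    α / 2 ≤ conv (conv (conv (ind A) (unif A)) (unif M)) (unif M) x := by
  set B := bohr Γ r₁
  set P := bohr Γ (r₁ + 6 * r₂)
  have hB : (0 : ℝ) < #B := card_bohr_pos hr₁
  have hA0 : (0 : ℝ) < #A := lt_of_lt_of_le (by positivity) hAc
  have hP : (#P : ℝ) ≤ 65 / 64 * #B :=
    (hreg.card_le (κ := 6 * κ) (by linarith) (by linarith) (by linarith)).trans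
      (mul_le_mul_of_nonneg_right (by linarith) hB.le)
  have hsum : ∑ y, conv (ind A) (unif M) y = #A := by
    rw [sum_conv, sum_ind, sum_unif hMn, mul_one]
  have hsupp (y : G) (hy : y ∉ P) : conv (ind A) (unif M) y = 0 := by
    rw [conv_unif, sum_eq_zero, zero_div]
    refine fun m hm => ind_of_notMem fun hym => hy ?_
    have hadd := add_mem_bohr (hA hym) (hM hm)
    rw [sub_add_cancel] at hadd
    exact bohr_mono (by linarith) hadd
  have hself := le_conv_self (x := x) (by linarith) (fun y => (hup y).le) hsupp
    (bohr_mono (by linarith) : B ⊆ P) fun y hy => bohr_mono (by linarith) (sub_mem_bohr hx hy)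
  rw [conv_conv_conv_unif, le_div_iff₀ hA0]
  refine le_trans ?_ hself
  rw [hsum]
  have hP' := mul_le_mul_of_nonneg_left hP (sq_nonneg α)
  have hAc' := mul_le_mul_of_nonneg_left hAc hα.le
  have hpos : 0 ≤ α ^ 2 * (#B : ℝ) := by positivity
  linarith

theorem half_sub_le_convIter_diffMeasure {A T M : Finset G} (hA : A.Nonempty) (hT : T.Nonempty)
    (hM : M.Nonempty) {X : ℕ → Finset G}
    (hX : ∀ n, ∀ x ∈ X (n + 1), ∀ s ∈ T, ∀ s' ∈ T, x + (s - s') ∈ X n) {c ζ ε : ℝ} {l : ℕ}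
    (hspec : ∀ γ, 1 / 2 ≤ ‖dft (unif T) γ‖ → ∀ x ∈ M, ‖γ x - 1‖ ≤ ζ)
    (hl : 2 * (1 / 4 : ℝ) ^ l ≤ ε) (hζ : 2 * ζ ≤ ε)
    (hc : ∀ x ∈ X 0, c ≤ conv (conv (conv (ind A) (unif A)) (unif M)) (unif M) x) :
    ∀ x ∈ X l, c - ε ≤ convIter (diffMeasure T) l (conv (ind A) (unif A)) x := by
  intro x hx
  have hiter := le_convIter_diffMeasure hT hX hc l x hx
  rw [← conv_conv_convIter] at hiter
  linarith [(abs_le.1 (abs_convIter_sub_conv_conv_le hA hM hspec hl hζ x)).1]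

theorem sum_convIter_diffMeasure_lt {T : Finset G} (hT : T.Nonempty) {X : ℕ → Finset G}
    (hX0 : ∀ n, X n ⊆ X 0)
    (hX : ∀ n, ∀ x ∈ X (n + 1), ∀ s ∈ T, ∀ s' ∈ T, x + (s - s') ∈ X n) {α : ℝ} (hα : 0 < α)
    (hα1 : α ≤ 1) {l : ℕ} (hl : 1 ≤ l) {f g : G → ℝ} (hf0 : ∀ x, 0 ≤ f x) (hf1 : ∀ x, f x ≤ 1)
    (hg : ∀ s ∈ T, AgreesOn (X 0) (1 / (60 * l)) (α ^ 2 / (1000 * l)) (fun x => g (x + s))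
      fun x => α + f x) {E : Finset G} (hE : E.Nonempty) (hEX : E ⊆ X l)
    (hX0c : 13 / 32 * α * #(X 0) ≤ #E) (hfE : ∑ x ∈ E, f x ≤ α / 100 * #E) :
    ∑ x ∈ E, convIter (diffMeasure T) l f x < 2 / 5 * α * #E := by
  have hl0 : (1 : ℝ) ≤ l := Nat.one_le_cast.2 hl
  have hE0 : (0 : ℝ) < #E := Nat.cast_pos.2 hE.card_pos
  have hδ : (1 : ℝ) / (60 * l) ≤ 1 / 3 := one_div_le_one_div_of_le (by norm_num) (by linarith)
  have hmain := sum_convIter_diffMeasure_le hT hX0 hX (M := 2) (by positivity) hδ (by positivity)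
    (fun x => add_nonneg hα.le (hf0 x)) (fun x => by linarith [hf1 x]) hg l E hEX
  have herr : l * (2 * (α ^ 2 / (1000 * l)) * #(X 0) * 2) ≤ α / 100 * #E := by
    calc l * (2 * (α ^ 2 / (1000 * l)) * #(X 0) * 2) = α / 250 * (α * #(X 0)) := by
          field_simp
          ring
      _ ≤ α / 250 * (32 / 13 * #E) :=
          mul_le_mul_of_nonneg_left (by linarith) (by positivity)
      _ ≤ α / 100 * #E := by linarith [mul_pos hα hE0]
  simp only [convIter_const_add (sum_diffMeasure hT), sum_add_distrib, sum_const,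
    nsmul_eq_mul] at hmain
  have hbound : (1 + 3 * (1 / (60 * l : ℝ))) ^ l * (#E * α + ∑ x ∈ E, f x +
      l * (2 * (α ^ 2 / (1000 * l)) * #(X 0) * 2)) ≤ 53 / 50 * (51 / 50 * (#E * α)) := by
    gcongr
    · have hsum0 := sum_nonneg fun x (_ : x ∈ E) => hf0 x
      positivity
    · exact one_add_three_mul_pow_le hl
    · linarith
  linarith [mul_pos hα hE0]

/-- The sets `Bohr(Γ, r + 2(l-n)σ)`: starting from a slight enlargement, they lose `2σ` of their
radius in each step and reach `Bohr(Γ, r)` after `l` steps. -/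
noncomputable def shrinkingBohr (Γ : Finset (AddChar G ℂ)) (r σ : ℝ) (l n : ℕ) : Finset G :=
  bohr Γ (r + 2 * (l - n) * σ)

section ShrinkingBohr

variable {Γ : Finset (AddChar G ℂ)} {r σ : ℝ} {l : ℕ}

theorem shrinkingBohr_self : shrinkingBohr Γ r σ l l = bohr Γ r := by
  simp [shrinkingBohr]

theorem shrinkingBohr_subset_zero (hσ : 0 ≤ σ) (n : ℕ) :
    shrinkingBohr Γ r σ l n ⊆ shrinkingBohr Γ r σ l 0 := by
  refine bohr_mono ?_
  gcongr
  exact n.zero_le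

theorem add_sub_mem_shrinkingBohr {n : ℕ} {x s s' : G} (hx : x ∈ shrinkingBohr Γ r σ l (n + 1))
    (hs : s ∈ bohr Γ σ) (hs' : s' ∈ bohr Γ σ) : x + (s - s') ∈ shrinkingBohr Γ r σ l n := by
  refine bohr_mono (le_of_eq ?_) (add_mem_bohr hx (sub_mem_bohr hs hs'))
  push_cast
  ring

theorem IsRegularRadius.card_le_two_mul {ρ : ℝ} (hreg : IsRegularRadius Γ r) (hΓ : 1 ≤ #Γ)
    (hρ : ρ ≤ r + r / (12 * #Γ)) : (#(bohr Γ ρ) : ℝ) ≤ 2 * #(bohr Γ r) := by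
  have hcancel : 12 * (#Γ : ℝ) * (1 / (12 * #Γ)) = 1 := by field_simp
  have hle := hreg.card_le (κ := 1 / (12 * #Γ)) (by positivity) hcancel.le
    (hρ.trans_eq (by ring))
  rw [hcancel] at hle
  linarith

theorem card_shrinkingBohr_zero_le (hreg : IsRegularRadius Γ r) (hΓ : 1 ≤ #Γ)
    (hσ : 2 * l * σ ≤ r / (12 * #Γ)) :
    (#(shrinkingBohr Γ r σ l 0) : ℝ) ≤ 2 * #(bohr Γ r) :=
  hreg.card_le_two_mul hΓ (by rw [Nat.cast_zero, sub_zero]; linarith)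

end ShrinkingBohr

variable {Γ : Finset (AddChar G ℂ)}

theorem exists_bohr_small_on_spectrum (hΓ : 1 ≤ #Γ) {σ ε : ℝ} (hσ : 0 ≤ σ) (hσ2 : σ ≤ 2)
    (hreg : IsRegularRadius Γ σ) (hε : 0 < ε) (hε1 : ε ≤ 1) {T : Finset G} (hT : T.Nonempty)
    (hTS : T ⊆ bohr Γ σ) {R : ℕ} (hR1 : 1 ≤ R)
    (hR : 8 * Real.log (4 * (#(bohr Γ σ) / #T)) < R) :
    ∃ (Δ : Finset (AddChar G ℂ)) (ω : ℝ), Γ ⊆ Δ ∧ (#Δ : ℝ) ≤ #Γ + R ∧ IsRegularRadius Δ ω ∧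
      0 ≤ ω ∧ ω ≤ σ ∧ ε * σ / (76800 * (#Γ : ℝ) ^ 2 * R ^ 2) ≤ ω ∧
      ∀ γ, 1 / 2 ≤ ‖dft (unif T) γ‖ → ∀ x ∈ bohr Δ ω, ‖γ x - 1‖ ≤ ε := by
  classical
  set d : ℝ := (#Γ : ℝ)
  have hd : 1 ≤ d := Nat.one_le_cast.2 hΓ
  have hR0 : (1 : ℝ) ≤ R := Nat.one_le_cast.2 hR1
  obtain ⟨v, hvl, hvu, hregv⟩ := exists_isRegularRadius hΓ (ρ := σ / (12 * d * R)) (by positivity)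
  have hv : 0 ≤ v := le_trans (by positivity) hvl
  have hRv : R * v ≤ σ / (12 * d) := by
    calc R * v ≤ R * (σ / (12 * d * R)) := by gcongr
      _ = σ / (12 * d) := by field_simp
  have hvσ : v ≤ σ := by
    calc v ≤ R * v := le_mul_of_one_le_left hv hR0
      _ ≤ σ / (12 * d) := hRv
      _ ≤ σ := div_le_self hσ (by linarith)
  obtain ⟨Λ, hΛcard, hΛ⟩ := exists_bohr_annihilating_spectrum hσ hv hregv hT hTS hR
    (hreg.card_le_two_mul hΓ (by linarith))
  set κ : ℝ := ε / (100 * d * R)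
  have hκd : d * κ ≤ ε / 100 := by
    calc d * κ = ε / 100 / R := by simp only [κ]; field_simp
      _ ≤ ε / 100 := div_le_self (by positivity) hR0
  have hκR : R * κ ≤ ε / 100 := by
    calc R * κ = ε / 100 / d := by simp only [κ]; field_simp
      _ ≤ ε / 100 := div_le_self (by positivity) hd
  have hκ : 0 ≤ κ := by positivity
  obtain ⟨ω, hωl, hωu, hregω⟩ := exists_isRegularRadius (Γ := Γ ∪ Λ) (ρ := κ * v)
    (hΓ.trans (card_le_card subset_union_left)) (by positivity)
  have hω : 0 ≤ ω := le_trans (by positivity) hωl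
  refine ⟨Γ ∪ Λ, ω, subset_union_left, ?_, hregω, hω, ?_, ?_, fun γ hγ x hx => ?_⟩
  · change (_ : ℝ) ≤ (#Γ : ℝ) + R
    exact_mod_cast (card_union_le Γ Λ).trans (Nat.add_le_add_left hΛcard.le _)
  · have hκ1 : κ ≤ 1 := by linarith [le_mul_of_one_le_left hκ hd]
    exact hωu.trans ((mul_le_of_le_one_left hv hκ1).trans hvσ)
  · calc ε * σ / (76800 * d ^ 2 * R ^ 2) = κ * (σ / (12 * d * R) / 8) / 8 := by
          simp only [κ]
          field_simp
          ring
      _ ≤ κ * v / 8 := by gcongr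
      _ ≤ ω := hωl
  · have hRω : R * ω ≤ ε / 100 * 2 := by
      calc R * ω ≤ R * (κ * v) := by gcongr
        _ = R * κ * v := by ring
        _ ≤ ε / 100 * 2 := by
          gcongr
          exact hvσ.trans hσ2
    linarith [hΛ γ hγ κ ω hκ (by linarith) hω hωu x hx]

theorem exists_almostPeriods_bohr (hΓ : 1 ≤ #Γ) {σ α : ℝ} (hσ : 0 ≤ σ) (hσ2 : σ ≤ 2)
    (hreg : IsRegularRadius Γ σ) (hα : 0 < α) (hα1 : α ≤ 1) {l : ℕ} (hl1 : 1 ≤ l)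
    (hl : l ≤ 10 * Real.log (2 / α)) {A AS : Finset G} (hA : A.Nonempty)
    (hAS : ∀ a ∈ A, ∀ s ∈ bohr Γ σ, a + s ∈ AS) (hK : (#AS : ℝ) ≤ 3 / α * #A) (X : Finset G) :
    ∃ (T : Finset G) (g : G → ℝ) (Δ : Finset (AddChar G ℂ)) (ω : ℝ),
      T.Nonempty ∧ T ⊆ bohr Γ σ ∧
      (∀ s ∈ T, AgreesOn X (1 / (60 * l)) (α ^ 2 / (1000 * l)) (fun x => g (x + s))
        fun x => α + conv (ind A) (unif A) x) ∧
      Γ ⊆ Δ ∧ (#Δ : ℝ) ≤ #Γ + 3 * 10 ^ 8 * α⁻¹ * Real.log (2 / α) ^ 4 ∧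
      IsRegularRadius Δ ω ∧ 0 ≤ ω ∧ ω ≤ σ ∧ α ^ 11 * σ / (10 ^ 26 * (#Γ : ℝ) ^ 2) ≤ ω ∧
      ∀ γ, 1 / 2 ≤ ‖dft (unif T) γ‖ → ∀ x ∈ bohr Δ ω, ‖γ x - 1‖ ≤ α / 40 := by
  have hl0 : (1 : ℝ) ≤ l := Nat.one_le_cast.2 hl1
  obtain ⟨k, R, hk, hR1, hkβ, hRlog, hRle⟩ := exists_numSamples_rank hα hα1 hl1 hl
  have hδ : (1 : ℝ) / (60 * l) ≤ 1 := div_le_one_of_le₀ (by linarith) (by positivity)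
  obtain ⟨T, hTS, hTcard, g, hg⟩ := exists_almostPeriods (X := X) hA (by positivity)
    (by positivity) hδ hk hkβ hAS hK
  have hT : T.Nonempty := by
    refine nonempty_iff_ne_empty.2 fun hempty => ?_
    rw [hempty, card_empty, Nat.cast_zero, mul_zero] at hTcard
    exact (card_bohr_pos hσ).not_ge hTcard
  have hT0 : (0 : ℝ) < #T := Nat.cast_pos.2 hT.card_pos
  have hS0 : (0 : ℝ) < #(bohr Γ σ) := card_bohr_pos hσ
  have hratio : 8 * Real.log (4 * (#(bohr Γ σ) / #T)) < R := by
    refine lt_of_le_of_lt ?_ hRlog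
    gcongr
    rwa [div_le_iff₀ hT0]
  obtain ⟨Δ, ω, hΓΔ, hΔcard, hregω, hω, hωσ, hωl, hspec⟩ := exists_bohr_small_on_spectrum hΓ hσ hσ2
    hreg (show 0 < α / 40 by positivity) (by linarith) hT hTS hR1 hratio
  refine ⟨T, g, Δ, ω, hT, hTS, hg, hΓΔ, by linarith, hregω, hω, hωσ, le_trans ?_ hωl, hspec⟩
  have hRα : ((R : ℝ) * α ^ 5) ^ 2 ≤ (48 * 10 ^ 8) ^ 2 :=
    pow_le_pow_left₀ (by positivity) (rank_mul_pow_five_le hα hα1 hRle) 2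
  rw [div_le_div_iff₀ (by positivity) (by positivity)]
  calc α ^ 11 * σ * (76800 * (#Γ : ℝ) ^ 2 * R ^ 2)
      = 76800 * (α * σ * (#Γ : ℝ) ^ 2) * ((R : ℝ) * α ^ 5) ^ 2 := by ring
    _ ≤ 76800 * (α * σ * (#Γ : ℝ) ^ 2) * (48 * 10 ^ 8) ^ 2 := by gcongr
    _ ≤ α / 40 * σ * (10 ^ 26 * (#Γ : ℝ) ^ 2) := by
      have hpos : 0 ≤ α * σ * (#Γ : ℝ) ^ 2 := by positivity
      linarith

theorem nonempty_of_density_le {Γ : Finset (AddChar G ℂ)} {r α : ℝ} (hr : 0 ≤ r) (hα : 0 < α)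
    {A : Finset G} (hA : 13 / 16 * α * #(bohr Γ r) ≤ #A) : A.Nonempty := by
  have hB := card_bohr_pos (Γ := Γ) hr
  exact card_pos.1 (Nat.cast_pos.1 (lt_of_lt_of_le (by positivity) hA))

theorem exists_shift_radius (hΓ : 1 ≤ #Γ) {r α : ℝ} (hr : 0 ≤ r) {l : ℕ} (hl : 1 ≤ l)
    (hlα : l * α ≤ 20) :
    ∃ σ, 0 ≤ σ ∧ 2 * l * σ ≤ r / (12 * #Γ) ∧ α * r / (3840 * #Γ) ≤ σ ∧ IsRegularRadius Γ σ := by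
  obtain ⟨σ, hσl, hσu, hregσ⟩ := exists_isRegularRadius hΓ (ρ := r / (24 * #Γ * l))
    (by positivity)
  refine ⟨σ, le_trans (by positivity) hσl, ?_, le_trans ?_ hσl, hregσ⟩
  · calc 2 * l * σ ≤ 2 * l * (r / (24 * #Γ * l)) := by gcongr
      _ = r / (12 * #Γ) := by
        field_simp
        ring
  · rw [div_div, div_le_div_iff₀ (by positivity) (by positivity)]
    calc α * r * (24 * #Γ * l * 8) = l * α * (192 * r * #Γ) := by ring
      _ ≤ 20 * (192 * r * #Γ) := by gcongr
      _ = r * (3840 * #Γ) := by ring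

/- The function `f = 1_{A₁} * μ_{A₁}` is small on average over `2 · A₂`, and smoothing by almost
periods keeps it small there. If `1_{A₁} * μ_M` were bounded by `9α/8`, then the smoothed function
would be close to `f * μ_M * μ_M`, which is at least `α/2` everywhere on `2 · A₂`. -/
theorem exists_le_conv_of_almostPeriods (hG : Odd (Fintype.card G)) (hΓ : 1 ≤ #Γ)
    {r₁ r₂ κ α σ : ℝ} (hr₁ : 0 ≤ r₁) (hr₂ : 0 ≤ r₂) (hreg₁ : IsRegularRadius Γ r₁)
    (hreg₂ : IsRegularRadius Γ r₂) (hκ : 0 ≤ κ) (hκ1 : 12 * (#Γ : ℝ) * (6 * κ) ≤ 1 / 64)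
    (hr : r₂ ≤ κ * r₁) (hα : 0 < α) (hα1 : α ≤ 1) {A₁ A₂ : Finset G} (hA₁ : A₁ ⊆ bohr Γ r₁)
    (hA₂ : A₂ ⊆ bohr Γ r₂) (hA₁c : 13 / 16 * α * #(bohr Γ r₁) ≤ #A₁)
    (hA₂c : 13 / 16 * α * #(bohr Γ r₂) ≤ #A₂)
    (hfew : ∑ b ∈ A₂, conv (ind A₁) (unif A₁) (2 • b) ≤ α / 100 * #A₂) {l : ℕ} (hl : 1 ≤ l)
    (hlα : 2 * (1 / 4 : ℝ) ^ l ≤ α / 20) (hσ : 0 ≤ σ) (hlσ : 2 * l * σ ≤ r₂ / (12 * #Γ))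
    {T M : Finset G} (hT : T.Nonempty) (hTσ : T ⊆ bohr (sqrtFreq Γ) σ) {g : G → ℝ}
    (hg : ∀ s ∈ T, AgreesOn (shrinkingBohr (sqrtFreq Γ) r₂ σ l 0) (1 / (60 * l))
      (α ^ 2 / (1000 * l)) (fun x => g (x + s)) fun x => α + conv (ind A₁) (unif A₁) x)
    (hM : M.Nonempty) (hMr : M ⊆ bohr Γ (2 * r₂))
    (hspec : ∀ γ, 1 / 2 ≤ ‖dft (unif T) γ‖ → ∀ x ∈ M, ‖γ x - 1‖ ≤ α / 40) :
    ∃ x, 9 / 8 * α ≤ conv (ind A₁) (unif M) x := by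
  by_contra! hup
  have hd : (1 : ℝ) ≤ #Γ := Nat.one_le_cast.2 hΓ
  have hΓ' : 1 ≤ #(sqrtFreq Γ) := by rwa [card_sqrtFreq hG]
  have hA₁ne : A₁.Nonempty := nonempty_of_density_le hr₁ hα hA₁c
  set f := conv (ind A₁) (unif A₁)
  set X := shrinkingBohr (sqrtFreq Γ) r₂ σ l with hX
  have hXT (n : ℕ) : ∀ x ∈ X (n + 1), ∀ s ∈ T, ∀ s' ∈ T, x + (s - s') ∈ X n :=
    fun x hx s hs s' hs' => add_sub_mem_shrinkingBohr hx (hTσ hs) (hTσ hs')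
  have hX0 : X 0 ⊆ bohr Γ (4 * r₂) := by
    refine (bohr_sqrtFreq_subset hG Γ _).trans (bohr_mono ?_)
    rw [Nat.cast_zero, sub_zero]
    linarith [div_le_self hr₂ (show 1 ≤ 12 * (#Γ : ℝ) by linarith)]
  set E := A₂.map ⟨fun x : G => 2 • x, (two_nsmul_bijective hG).1⟩
  have hEX : E ⊆ X l := fun y hy => by
    obtain ⟨b, hb, rfl⟩ := mem_map.1 hy
    rw [hX, shrinkingBohr_self]
    exact (two_nsmul_mem_bohr_sqrtFreq hG).2 (hA₂ hb)
  have hlower := half_sub_le_convIter_diffMeasure hA₁ne hT hM hXT hspec hlα (by linarith)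
    fun x hx => half_le_conv_conv hr₁ hr₂ hreg₁ hκ hκ1 hr hα hA₁ hA₁c hM hMr hup (hX0 hx)
  have hX0c : (#(X 0) : ℝ) ≤ 2 * #(bohr Γ r₂) := by
    rw [← card_bohr_sqrtFreq hG Γ r₂]
    exact card_shrinkingBohr_zero_le (hreg₂.sqrtFreq hG) hΓ' (by rwa [card_sqrtFreq hG])
  have hupper : ∑ x ∈ E, convIter (diffMeasure T) l f x < 2 / 5 * α * #E := by
    refine sum_convIter_diffMeasure_lt hT (shrinkingBohr_subset_zero hσ) hXT hα hα1 hl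
      (conv_ind_unif_nonneg A₁ A₁) (conv_ind_unif_le_one A₁ A₁) hg
      (map_nonempty.2 (nonempty_of_density_le hr₂ hα hA₂c)) hEX ?_ ?_
    · rw [card_map]
      linarith [mul_le_mul_of_nonneg_left hX0c hα.le]
    · rwa [card_map, sum_map]
  have hsum := card_nsmul_le_sum E _ _ fun x hx => hlower x (hEX hx)
  rw [nsmul_eq_mul] at hsum
  have hE0 : 0 ≤ α * (#E : ℝ) := by positivity
  linarith

theorem exists_increment (hG : Odd (Fintype.card G)) (hΓ : 1 ≤ #Γ) {r₁ r₂ κ α : ℝ} (hr₁ : 0 ≤ r₁)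
    (hr₂ : 0 ≤ r₂) (hr₂2 : r₂ ≤ 2) (hreg₁ : IsRegularRadius Γ r₁) (hreg₂ : IsRegularRadius Γ r₂)
    (hκ : 0 ≤ κ) (hκ1 : 12 * (#Γ : ℝ) * (6 * κ) ≤ 1 / 64) (hr : r₂ ≤ κ * r₁) (hα : 0 < α)
    (hα1 : α ≤ 1) {A₁ A₂ : Finset G} (hA₁ : A₁ ⊆ bohr Γ r₁) (hA₂ : A₂ ⊆ bohr Γ r₂)
    (hA₁c : 13 / 16 * α * #(bohr Γ r₁) ≤ #A₁) (hA₂c : 13 / 16 * α * #(bohr Γ r₂) ≤ #A₂)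
    (hfew : ∑ b ∈ A₂, conv (ind A₁) (unif A₁) (2 • b) ≤ α / 100 * #A₂) :
    ∃ (Δ : Finset (AddChar G ℂ)) (ω : ℝ), 0 ≤ ω ∧ ω ≤ r₂ ∧ sqrtFreq Γ ⊆ Δ ∧ IsRegularRadius Δ ω ∧
      (#Δ : ℝ) ≤ #Γ + 3 * 10 ^ 8 * α⁻¹ * Real.log (2 / α) ^ 4 ∧
      α ^ 12 * r₂ / (10 ^ 30 * (#Γ : ℝ) ^ 3) ≤ ω ∧
      ∃ x, 9 / 8 * α ≤ conv (ind A₁) (unif (bohr Δ ω)) x := by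
  have hd : (1 : ℝ) ≤ #Γ := Nat.one_le_cast.2 hΓ
  have hΓ' : 1 ≤ #(sqrtFreq Γ) := by rwa [card_sqrtFreq hG]
  obtain ⟨l, hl1, hlL, hlα⟩ := exists_numFactors hα hα1
  have hl0 : (1 : ℝ) ≤ l := Nat.one_le_cast.2 hl1
  obtain ⟨σ, hσ, hlσ, hσl, hregσ⟩ := exists_shift_radius hΓ' hr₂ hl1 (nat_mul_le_twenty hα hlL)
  rw [card_sqrtFreq hG] at hlσ hσl
  have hσr : 2 * σ ≤ r₂ := by
    linarith [le_mul_of_one_le_left hσ hl0, div_le_self hr₂ (show 1 ≤ 12 * (#Γ : ℝ) by linarith)]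
  have hA₁ne : A₁.Nonempty := nonempty_of_density_le hr₁ hα hA₁c
  have hK : (#(bohr Γ (r₁ + r₂)) : ℝ) ≤ 3 / α * #A₁ := by
    have hle := hreg₁.card_le (κ := κ) (σ := r₁ + r₂) hκ (by linarith) (by linarith)
    have hle2 : (#(bohr Γ (r₁ + r₂)) : ℝ) ≤ 2 * #(bohr Γ r₁) := hle.trans (by
      gcongr
      linarith)
    rw [div_mul_eq_mul_div, le_div_iff₀ hα]
    linarith [mul_le_mul_of_nonneg_right hle2 hα.le]
  obtain ⟨T, g, Δ, ω, hT, hTσ, hg, hΔ, hΔc, hregω, hω, hωσ, hωl, hspec⟩ :=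
    exists_almostPeriods_bohr hΓ' hσ (by linarith) hregσ hα hα1 hl1 hlL hA₁ne
      (fun a ha s hs => add_mem_bohr (hA₁ ha) (bohr_mono hσr (bohr_sqrtFreq_subset hG Γ σ hs))) hK
      (shrinkingBohr (sqrtFreq Γ) r₂ σ l 0)
  rw [card_sqrtFreq hG] at hΔc hωl
  have hM : bohr Δ ω ⊆ bohr Γ (2 * r₂) :=
    (bohr_anti hΔ).trans ((bohr_sqrtFreq_subset hG Γ ω).trans (bohr_mono (by linarith)))
  refine ⟨Δ, ω, hω, by linarith, hΔ, hregω, hΔc, le_trans ?_ hωl,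
    exists_le_conv_of_almostPeriods hG hΓ hr₁ hr₂ hreg₁ hreg₂ hκ hκ1 hr hα hα1 hA₁ hA₂ hA₁c hA₂c
      hfew hl1 hlα hσ hlσ hT hTσ hg (bohr_nonempty hω) hM hspec⟩
  calc α ^ 12 * r₂ / (10 ^ 30 * (#Γ : ℝ) ^ 3)
      ≤ α ^ 12 * r₂ / (10 ^ 26 * 3840 * (#Γ : ℝ) ^ 3) := by
        gcongr
        norm_num
    _ = α ^ 11 * (α * r₂ / (3840 * #Γ)) / (10 ^ 26 * (#Γ : ℝ) ^ 2) := by field_simp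
    _ ≤ α ^ 11 * σ / (10 ^ 26 * (#Γ : ℝ) ^ 2) := by gcongr

end Increment

section Main

variable {G : Type*} [AddCommGroup G] [Fintype G] {Γ : Finset (AddChar G ℂ)} {α ρ r r₁ r₂ κ : ℝ}

theorem card_bohr_le_pow_mul_card_bohr {τ Q : ℝ} {k : ℕ} (hρ : 0 ≤ ρ) (hτ : 0 < τ) (hτ1 : τ ≤ 1)
    (hQ : 5 / τ ≤ Q ^ k) (hr : τ * ρ ≤ r) : (#(bohr Γ ρ) : ℝ) ≤ Q ^ (k * #Γ) * #(bohr Γ r) := by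
  calc (#(bohr Γ ρ) : ℝ) ≤ (5 / τ) ^ #Γ * #(bohr Γ (τ * ρ)) :=
        card_bohr_le_mul_card_bohr Γ hρ hτ hτ1
    _ ≤ (Q ^ k) ^ #Γ * #(bohr Γ r) := by
        have hQk : 0 ≤ Q ^ k := le_trans (by positivity) hQ
        gcongr ?_ ^ _ * ?_
        exact card_bohr_mono hr
    _ = Q ^ (k * #Γ) * #(bohr Γ r) := by rw [pow_mul]

theorem exp_neg_mul_log_le_inv_pow {Q c : ℝ} {n : ℕ} (hQ : 1 ≤ Q) (hn : n ≤ c) :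
    Real.exp (-(c * Real.log Q)) ≤ (Q ^ n)⁻¹ := by
  rw [Real.exp_neg]
  refine inv_anti₀ (by positivity) ?_
  rw [← Real.exp_log (show 0 < Q ^ n by positivity), Real.log_pow]
  have hlog : 0 ≤ Real.log Q := Real.log_nonneg hQ
  gcongr

theorem exists_isRegularRadius_pair (hΓ : 1 ≤ #Γ) (hρ : 0 ≤ ρ) (hα : 0 < α) (hα1 : α ≤ 1) :
    ∃ r₁ r₂, 0 ≤ r₂ ∧ 2 * r₁ ≤ ρ ∧ r₁ ≤ α / (400 * #Γ) * ρ ∧ r₂ ≤ 1 / (5000 * #Γ) * r₁ ∧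
      r₂ ≤ r₁ ∧ α / (3200 * #Γ) * ρ ≤ r₁ ∧ α / (128000000 * (#Γ : ℝ) ^ 2) * ρ ≤ r₂ ∧
      IsRegularRadius Γ r₁ ∧ IsRegularRadius Γ r₂ := by
  have hd : (1 : ℝ) ≤ #Γ := Nat.one_le_cast.2 hΓ
  obtain ⟨r₁, hr₁l, hr₁u, hreg₁⟩ := exists_isRegularRadius hΓ (ρ := α / (400 * #Γ) * ρ)
    (by positivity)
  have hr₁l' : α / (3200 * #Γ) * ρ ≤ r₁ := le_trans (le_of_eq (by
    field_simp
    ring)) hr₁l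
  have hr₁ : 0 ≤ r₁ := le_trans (by positivity) hr₁l
  obtain ⟨r₂, hr₂l, hr₂u, hreg₂⟩ := exists_isRegularRadius hΓ (ρ := 1 / (5000 * #Γ) * r₁)
    (by positivity)
  refine ⟨r₁, r₂, le_trans (by positivity) hr₂l, ?_, hr₁u, hr₂u, hr₂u.trans ?_, hr₁l', ?_, hreg₁,
    hreg₂⟩
  · have hle : α / (400 * #Γ) ≤ 1 / 2 := by
      rw [div_le_div_iff₀ (by positivity) (by norm_num)]
      linarith
    linarith [mul_le_mul_of_nonneg_right hle hρ]
  · exact mul_le_of_le_one_left hr₁ (div_le_one_of_le₀ (by linarith) (by positivity))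
  · calc α / (128000000 * (#Γ : ℝ) ^ 2) * ρ = 1 / (5000 * #Γ) * (α / (3200 * #Γ) * ρ) / 8 := by
          field_simp
          ring
      _ ≤ 1 / (5000 * #Γ) * r₁ / 8 := by gcongr
      _ ≤ r₂ := hr₂l

/- By regularity the two densities sum to about `2α` on average, so if neither exceeds `9α/8`, then
at some point neither is much below `α`. -/
theorem exists_le_conv_and_le_conv (hreg : IsRegularRadius Γ ρ) (hρ : 0 ≤ ρ) (hκ : 0 ≤ κ)
    (hκ1 : 12 * (#Γ : ℝ) * κ ≤ 1) (hκα : 12 * (#Γ : ℝ) * κ ≤ 1 / 32 * α)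
    (hr₁ : 0 ≤ r₁) (hr₁κ : r₁ ≤ κ * ρ) (hr₂ : 0 ≤ r₂) (hr₂κ : r₂ ≤ κ * ρ) {A : Finset G}
    (hA : A ⊆ bohr Γ ρ) (hAc : α * #(bohr Γ ρ) ≤ #A)
    (hup₁ : ∀ x, conv (ind A) (unif (bohr Γ r₁)) x < 9 / 8 * α)
    (hup₂ : ∀ x, conv (ind A) (unif (bohr Γ r₂)) x < 9 / 8 * α) :
    ∃ u, 13 / 16 * α ≤ conv (ind A) (unif (bohr Γ r₁)) u ∧
      13 / 16 * α ≤ conv (ind A) (unif (bohr Γ r₂)) u := by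
  have hsum : ∑ _x ∈ bohr Γ ρ, 31 / 16 * α ≤ ∑ x ∈ bohr Γ ρ,
      (conv (ind A) (unif (bohr Γ r₁)) x + conv (ind A) (unif (bohr Γ r₂)) x) := by
    have hs₁ := sub_le_sum_conv_ind_unif_bohr hreg hκ hκ1 hr₁ hr₁κ hA
    have hs₂ := sub_le_sum_conv_ind_unif_bohr hreg hκ hκ1 hr₂ hr₂κ hA
    rw [sum_const, nsmul_eq_mul, sum_add_distrib]
    linarith [mul_le_mul_of_nonneg_right hκα (card_bohr_pos (Γ := Γ) hρ).le]
  obtain ⟨u, -, hu⟩ := exists_le_of_sum_le (bohr_nonempty hρ) hsum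
  exact ⟨u, by linarith [hup₂ u], by linarith [hup₁ u]⟩

theorem scale_bounds {d Q : ℝ} (hα : 0 < α) (hα1 : α ≤ 1) (hd : 1 ≤ d) (hQ : Q = 2 * d / α) :
    5 / (α / (3200 * d)) ≤ Q ^ 14 ∧ 5 / (α / (128000000 * d ^ 2)) ≤ Q ^ 30 ∧
      200 / α ^ 3 ≤ Q ^ 11 := by
  have hQα : 1 / α ≤ Q := by
    rw [hQ]
    gcongr
    linarith
  have hQ2 : 2 ≤ Q := by
    rw [hQ, le_div_iff₀ hα]
    linarith
  have hpow (n : ℕ) : (2 : ℝ) ^ n ≤ Q ^ n := by gcongr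
  refine ⟨?_, ?_, ?_⟩
  · calc 5 / (α / (3200 * d)) = 8000 * Q := by
          rw [hQ]
          field_simp
          ring
      _ ≤ Q ^ 13 * Q := by
        gcongr
        linarith [hpow 13]
      _ = Q ^ 14 := by ring
  · calc 5 / (α / (128000000 * d ^ 2)) = 160000000 * Q ^ 2 * α := by
          rw [hQ]
          field_simp
          ring
      _ ≤ Q ^ 28 * Q ^ 2 * 1 := by
        gcongr
        linarith [hpow 28]
      _ = Q ^ 30 := by ring
  · calc 200 / α ^ 3 = 200 * (1 / α) ^ 3 := by rw [one_div, inv_pow, div_eq_mul_inv]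
      _ ≤ Q ^ 8 * Q ^ 3 := by
        gcongr
        linarith [hpow 8]
      _ = Q ^ 11 := by ring

theorem exp_neg_mul_sq_card_bohr_le (hΓ : 1 ≤ #Γ) (hρ : 0 ≤ ρ) (hα : 0 < α) (hα1 : α ≤ 1)
    (hr₁ : α / (3200 * #Γ) * ρ ≤ r₁) (hr₂ : α / (128000000 * (#Γ : ℝ) ^ 2) * ρ ≤ r₂) :
    Real.exp (-(3 * 10 ^ 8 * #Γ * Real.log (2 * #Γ / α))) * (#(bohr Γ ρ) : ℝ) ^ 2 ≤
      α ^ 3 / 200 * (#(bohr Γ r₁) * #(bohr Γ r₂)) := by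
  have hd : (1 : ℝ) ≤ #Γ := Nat.one_le_cast.2 hΓ
  set Q : ℝ := 2 * #Γ / α with hQ
  have hQ1 : 1 ≤ Q := by
    rw [hQ, le_div_iff₀ hα]
    linarith
  obtain ⟨hscale₁, hscale₂, hconst⟩ := scale_bounds hα hα1 hd hQ
  have hcard₁ : (#(bohr Γ ρ) : ℝ) ≤ Q ^ (14 * #Γ) * #(bohr Γ r₁) :=
    card_bohr_le_pow_mul_card_bohr hρ (by positivity)
      (div_le_one_of_le₀ (by linarith) (by positivity)) hscale₁ hr₁
  have hcard₂ : (#(bohr Γ ρ) : ℝ) ≤ Q ^ (30 * #Γ) * #(bohr Γ r₂) :=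
    card_bohr_le_pow_mul_card_bohr hρ (by positivity)
      (div_le_one_of_le₀ (by linarith [one_le_pow₀ hd (n := 2)]) (by positivity)) hscale₂ hr₂
  have hexp : Real.exp (-(3 * 10 ^ 8 * #Γ * Real.log Q)) ≤ (Q ^ (55 * #Γ))⁻¹ := by
    refine exp_neg_mul_log_le_inv_pow hQ1 ?_
    push_cast
    linarith
  calc Real.exp (-(3 * 10 ^ 8 * #Γ * Real.log Q)) * (#(bohr Γ ρ) : ℝ) ^ 2
      ≤ (Q ^ (55 * #Γ))⁻¹ *
          (Q ^ (14 * #Γ) * #(bohr Γ r₁) * (Q ^ (30 * #Γ) * #(bohr Γ r₂))) := by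
        rw [sq]
        gcongr
    _ = (Q ^ (11 * #Γ))⁻¹ * (#(bohr Γ r₁) * #(bohr Γ r₂)) := by
        rw [show 55 * #Γ = 11 * #Γ + 14 * #Γ + 30 * #Γ by ring, pow_add, pow_add]
        field_simp
    _ ≤ (200 / α ^ 3)⁻¹ * (#(bohr Γ r₁) * #(bohr Γ r₂)) := by
        gcongr
        exact hconst.trans (pow_le_pow_right₀ hQ1 (by lia))
    _ = α ^ 3 / 200 * (#(bohr Γ r₁) * #(bohr Γ r₂)) := by rw [inv_div]

theorem exp_neg_mul_sq_card_le_numAP (hΓ : 1 ≤ #Γ) (hρ : 0 ≤ ρ) (hα : 0 < α) (hα1 : α ≤ 1)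
    (hr₁ : α / (3200 * #Γ) * ρ ≤ r₁) (hr₂ : α / (128000000 * (#Γ : ℝ) ^ 2) * ρ ≤ r₂)
    {A A₁ A₂ : Finset G} (hA : A ⊆ bohr Γ ρ) {u : G} (hA₁ : A₁ = translatePart A (bohr Γ r₁) u)
    (hA₂ : A₂ = translatePart A (bohr Γ r₂) u) (hA₁c : 13 / 16 * α * #(bohr Γ r₁) ≤ #A₁)
    (hA₂c : 13 / 16 * α * #(bohr Γ r₂) ≤ #A₂)
    (hmany : α / 100 * #A₂ ≤ ∑ b ∈ A₂, conv (ind A₁) (unif A₁) (2 • b)) :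
    Real.exp (-(3 * 10 ^ 8 * #Γ * Real.log (2 * #Γ / α))) * (#A : ℝ) ^ 2 ≤ numAP A := by
  calc Real.exp (-(3 * 10 ^ 8 * #Γ * Real.log (2 * #Γ / α))) * (#A : ℝ) ^ 2
      ≤ Real.exp (-(3 * 10 ^ 8 * #Γ * Real.log (2 * #Γ / α))) * (#(bohr Γ ρ) : ℝ) ^ 2 := by
        gcongr
    _ ≤ α ^ 3 / 200 * (#(bohr Γ r₁) * #(bohr Γ r₂)) :=
        exp_neg_mul_sq_card_bohr_le hΓ hρ hα hα1 hr₁ hr₂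
    _ ≤ (13 / 16 * α * #(bohr Γ r₁)) * (α / 100 * (13 / 16 * α * #(bohr Γ r₂))) := by
        have hpos : 0 ≤ α ^ 3 * (#(bohr Γ r₁) * #(bohr Γ r₂) : ℝ) := by positivity
        linarith
    _ ≤ #A₁ * (α / 100 * #A₂) := by gcongr
    _ ≤ #A₁ * ∑ b ∈ A₂, conv (ind A₁) (unif A₁) (2 • b) := by gcongr
    _ ≤ numAP A := by
        rw [hA₁, hA₂]
        exact card_mul_sum_conv_le_numAP A (bohr Γ r₁) (bohr Γ r₂) u

theorem exp_neg_mul_sq_card_le_numAP_or_increment_of_le_conv (hG : Odd (Fintype.card G))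
    (hΓ : 1 ≤ #Γ) (hρ : 0 ≤ ρ) (hρ2 : ρ ≤ 2) (hα : 0 < α) (hα1 : α ≤ 1) (hr₂ : 0 ≤ r₂)
    (hr₁ρ : 2 * r₁ ≤ ρ) (hr₂κ : r₂ ≤ 1 / (5000 * #Γ) * r₁) (hr₂r₁ : r₂ ≤ r₁)
    (hr₁l : α / (3200 * #Γ) * ρ ≤ r₁) (hr₂l : α / (128000000 * (#Γ : ℝ) ^ 2) * ρ ≤ r₂)
    (hreg₁ : IsRegularRadius Γ r₁) (hreg₂ : IsRegularRadius Γ r₂) {A : Finset G}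
    (hA : A ⊆ bohr Γ ρ) {u : G} (hu₁ : 13 / 16 * α ≤ conv (ind A) (unif (bohr Γ r₁)) u)
    (hu₂ : 13 / 16 * α ≤ conv (ind A) (unif (bohr Γ r₂)) u) :
    Real.exp (-(3 * 10 ^ 8 * #Γ * Real.log (2 * #Γ / α))) * (#A : ℝ) ^ 2 ≤ numAP A ∨
    ∃ (Δ : Finset (AddChar G ℂ)) (ω : ℝ), 0 ≤ ω ∧ ω ≤ r₂ ∧ sqrtFreq Γ ⊆ Δ ∧ IsRegularRadius Δ ω ∧
      (#Δ : ℝ) ≤ #Γ + 3 * 10 ^ 8 * α⁻¹ * Real.log (2 / α) ^ 4 ∧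
      α ^ 12 * r₂ / (10 ^ 30 * (#Γ : ℝ) ^ 3) ≤ ω ∧
      ∃ x, 9 / 8 * α ≤ conv (ind A) (unif (bohr Δ ω)) x := by
  have hr₁ : 0 ≤ r₁ := hr₂.trans hr₂r₁
  set A₁ := translatePart A (bohr Γ r₁) u with hA₁
  set A₂ := translatePart A (bohr Γ r₂) u with hA₂
  have hA₁c : 13 / 16 * α * #(bohr Γ r₁) ≤ #A₁ := by
    rw [hA₁, card_translatePart hr₁]
    gcongr
  have hA₂c : 13 / 16 * α * #(bohr Γ r₂) ≤ #A₂ := by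
    rw [hA₂, card_translatePart hr₂]
    gcongr
  rcases le_total (α / 100 * #A₂) (∑ b ∈ A₂, conv (ind A₁) (unif A₁) (2 • b)) with hmany | hfew
  · exact .inl (exp_neg_mul_sq_card_le_numAP hΓ hρ hα hα1 hr₁l hr₂l hA hA₁ hA₂ hA₁c hA₂c hmany)
  · have hκ : 12 * (#Γ : ℝ) * (6 * (1 / (5000 * #Γ))) = 72 / 5000 := by
      field_simp
      norm_num
    obtain ⟨Δ, ω, hω, hωr₂, hΔ, hregω, hΔc, hωl, x, hx⟩ := exists_increment hG hΓ hr₁ hr₂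
      (by linarith) hreg₁ hreg₂ (κ := 1 / (5000 * #Γ)) (by positivity) (by linarith) hr₂κ hα hα1
      (fun y hy => (mem_translatePart.1 hy).1) (fun y hy => (mem_translatePart.1 hy).1) hA₁c hA₂c
      hfew
    exact .inr ⟨Δ, ω, hω, hωr₂, hΔ, hregω, hΔc, hωl, u + x,
      hx.trans (conv_ind_translatePart_le _ _ _ _ _)⟩

theorem pow_thirteen_mul_div_le {d : ℝ} (hα : 0 < α) (hρ : 0 ≤ ρ) (hd : 1 ≤ d)
    (hr : α / (128000000 * d ^ 2) * ρ ≤ r) :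
    α ^ 13 * ρ / (10 ^ 40 * d ^ 5) ≤ α ^ 12 * r / (10 ^ 30 * d ^ 3) := by
  calc α ^ 13 * ρ / (10 ^ 40 * d ^ 5) ≤ α ^ 13 * ρ / (10 ^ 30 * 128000000 * d ^ 5) := by
        gcongr
        norm_num
    _ = α ^ 12 * (α / (128000000 * d ^ 2) * ρ) / (10 ^ 30 * d ^ 3) := by field_simp
    _ ≤ α ^ 12 * r / (10 ^ 30 * d ^ 3) := by gcongr

theorem exp_neg_mul_sq_card_le_numAP_or_increment (hG : Odd (Fintype.card G)) (hΓ : 1 ≤ #Γ)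
    (hρ : 0 ≤ ρ) (hρ2 : ρ ≤ 2) (hreg : IsRegularRadius Γ ρ) {A : Finset G} (hA : A ⊆ bohr Γ ρ)
    (hα : 0 < α) (hα1 : α ≤ 1) (hAc : α * #(bohr Γ ρ) ≤ #A) :
    Real.exp (-(3 * 10 ^ 8 * #Γ * Real.log (2 * #Γ / α))) * (#A : ℝ) ^ 2 ≤ numAP A ∨
    ∃ (Δ : Finset (AddChar G ℂ)) (ω : ℝ), 0 ≤ ω ∧ 2 * ω ≤ ρ ∧ (Γ ⊆ Δ ∨ sqrtFreq Γ ⊆ Δ) ∧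
      IsRegularRadius Δ ω ∧ (#Δ : ℝ) ≤ #Γ + 3 * 10 ^ 8 * α⁻¹ * Real.log (2 / α) ^ 4 ∧
      α ^ 13 * ρ / (10 ^ 40 * (#Γ : ℝ) ^ 5) ≤ ω ∧
      ∃ x, 9 / 8 * α ≤ conv (ind A) (unif (bohr Δ ω)) x := by
  have hd : (1 : ℝ) ≤ #Γ := Nat.one_le_cast.2 hΓ
  obtain ⟨r₁, r₂, hr₂, hr₁ρ, hr₁κ, hr₂κ, hr₂r₁, hr₁l, hr₂l, hreg₁, hreg₂⟩ :=
    exists_isRegularRadius_pair hΓ hρ hα hα1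
  have hr₁ : 0 ≤ r₁ := hr₂.trans hr₂r₁
  have hrad : α ^ 13 * ρ / (10 ^ 40 * (#Γ : ℝ) ^ 5) ≤ α ^ 12 * r₂ / (10 ^ 30 * (#Γ : ℝ) ^ 3) :=
    pow_thirteen_mul_div_le hα hρ hd hr₂l
  have hrad₂ : α ^ 12 * r₂ / (10 ^ 30 * (#Γ : ℝ) ^ 3) ≤ r₂ := by
    refine div_le_of_le_mul₀ (by positivity) hr₂ ?_
    rw [mul_comm]
    gcongr
    exact (pow_le_one₀ hα.le hα1).trans (by linarith [one_le_pow₀ hd (n := 3)])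
  have hrank : (#Γ : ℝ) ≤ #Γ + 3 * 10 ^ 8 * α⁻¹ * Real.log (2 / α) ^ 4 :=
    le_add_of_nonneg_right (by positivity)
  rw [or_iff_not_imp_right]
  intro hnone
  have hup₁ (x : G) : conv (ind A) (unif (bohr Γ r₁)) x < 9 / 8 * α := by
    by_contra! hx
    exact hnone ⟨Γ, r₁, hr₁, hr₁ρ, .inl Subset.rfl, hreg₁, hrank,
      (hrad.trans hrad₂).trans hr₂r₁, x, hx⟩
  have hup₂ (x : G) : conv (ind A) (unif (bohr Γ r₂)) x < 9 / 8 * α := by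
    by_contra! hx
    exact hnone ⟨Γ, r₂, hr₂, by linarith, .inl Subset.rfl, hreg₂, hrank, hrad.trans hrad₂, x, hx⟩
  have hκ : 12 * (#Γ : ℝ) * (α / (400 * #Γ)) = 3 / 100 * α := by
    field_simp
    ring
  obtain ⟨u, hu₁, hu₂⟩ := exists_le_conv_and_le_conv hreg hρ (κ := α / (400 * #Γ)) (by positivity)
    (by linarith) (by linarith) hr₁ hr₁κ hr₂ (hr₂r₁.trans hr₁κ) hA hAc hup₁ hup₂
  have hcount := exp_neg_mul_sq_card_le_numAP_or_increment_of_le_conv hG hΓ hρ hρ2 hα hα1 hr₂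
    hr₁ρ hr₂κ hr₂r₁ hr₁l hr₂l hreg₁ hreg₂ hA hu₁ hu₂
  refine hcount.resolve_right fun ⟨Δ, ω, hω, hωr₂, hΔ, hregω, hΔc, hωl, hx⟩ => ?_
  exact hnone ⟨Δ, ω, hω, by linarith, .inr hΔ, hregω, hΔc, hrad.trans hωl, hx⟩

theorem le_radius_of_pow_le {d : ℝ} (hα : 0 < α) (hα1 : α ≤ 1) (hρ : 0 ≤ ρ) (hd : 0 ≤ d)
    (h : α ^ 13 * ρ / (10 ^ 40 * d ^ 5) ≤ r) :
    1 / 10 ^ 40 * ρ * α ^ (3 * 10 ^ 8 * Real.log (2 / α)) / d ^ 5 ≤ r := by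
  have hexp : α ^ (3 * 10 ^ 8 * Real.log (2 / α)) ≤ α ^ 13 := by
    rw [← Real.rpow_natCast α 13]
    refine Real.rpow_le_rpow_of_exponent_ge hα hα1 ?_
    push_cast
    linarith [le_log_two_div hα hα1]
  calc 1 / 10 ^ 40 * ρ * α ^ (3 * 10 ^ 8 * Real.log (2 / α)) / d ^ 5
      ≤ 1 / 10 ^ 40 * ρ * α ^ 13 / d ^ 5 := by gcongr
    _ = α ^ 13 * ρ / (10 ^ 40 * d ^ 5) := by field_simp
    _ ≤ r := h

end Main

theorem mainTheorem3 :
    ∃ c C : ℝ, 0 < c ∧ 0 < C ∧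
      ∀ (G : Type*) [AddCommGroup G] [Fintype G], Odd (Fintype.card G) →
      ∀ B : BohrSet G, B.IsRegular → 1 ≤ B.rank → B.radius ≤ 2 →
      ∀ A : Finset G, A ⊆ B.carrier →
      ∀ α : ℝ, 0 < α → α ≤ (A.card : ℝ) / (B.carrier.card : ℝ) →
        Real.exp (-(C * (B.rank : ℝ) * Real.log (2 * (B.rank : ℝ) / α))) * (A.card : ℝ) ^ 2
            ≤ (numAP A : ℝ) ∨
        ∃ T : BohrSet G, T.IsRegular ∧ (T ≤ B ∨ T ≤ B.double) ∧ T.carrier ⊆ B.carrier ∧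
          (T.rank : ℝ) ≤ (B.rank : ℝ) + C * α⁻¹ * Real.log (2 / α) ^ 4 ∧
          c * B.radius * α ^ (C * Real.log (2 / α)) / (B.rank : ℝ) ^ 5 ≤ T.radius ∧
          9 / 8 * α ≤ supNorm (conv (ind A) (unif T.carrier)) := by
  refine ⟨1 / 10 ^ 40, 3 * 10 ^ 8, by norm_num, by norm_num, ?_⟩
  intro G _ _ hG B hreg hrank hρ2 A hA α hα hAα
  have hB : (0 : ℝ) < #B.carrier := card_bohr_pos B.radius_nonneg
  have hα1 : α ≤ 1 := hAα.trans (div_le_one_of_le₀ (mod_cast card_le_card hA) hB.le)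
  rw [BohrSet.isRegular_iff] at hreg
  rcases exp_neg_mul_sq_card_le_numAP_or_increment hG hrank B.radius_nonneg hρ2 hreg hA hα hα1
    ((le_div_iff₀ hB).1 hAα) with hmany | ⟨Δ, ω, hω, hωρ, hΔ, hregω, hΔc, hωl, x, hx⟩
  · exact .inl hmany
  have hωB : ω ≤ B.radius := by linarith
  refine .inr ⟨⟨Δ, ω, hω⟩, (BohrSet.isRegular_iff _).2 hregω,
    hΔ.imp (fun h => ⟨h, hωB⟩) fun h => ⟨h, hωB⟩, ?_, hΔc,
    le_radius_of_pow_le hα hα1 B.radius_nonneg (Nat.cast_nonneg _) hωl,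
    hx.trans (le_supNorm _ x)⟩
  change bohr Δ ω ⊆ bohr B.freq B.radius
  rcases hΔ with h | h
  · exact (bohr_anti h).trans (bohr_mono hωB)
  · exact (bohr_anti h).trans ((bohr_sqrtFreq_subset hG _ ω).trans (bohr_mono hωρ))
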